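/- Let $m,g,L,\mu,K_p,K_d,T_p>0$ and $p_d\in\mathbb R^3$ with $\|p_d\|=L$. For $\|p\|=L$ put $\hat r=p/L$, $\operatorname{dist}(p,p_d)=L\arccos\langle p/L,p_d/L\rangle$, $\hat t=\dfrac{(p\times p_d)\times p}{\max\{\|(p\times p_d)\times p\|,\mu\}}$, and consider the outer loop on the sphere $$m\ddot p=K_p\operatorname{dist}(p,p_d)\,\hat t-K_d\dot p+\delta_{\tilde\zeta},\qquad \|p(t)\|=L\ \text{for all }t,$$ where the equation is understood up to the reaction force of the constraint, which is normal to the sphere (Carathéodory solutions), and $\delta_{\tilde\zeta}=T\,R_d(\tilde R^{T}-I)\hat z$ with $T$ the thrust, $R_d\in SO(3)$ the desired attitude, and $\tilde R$ the attitude error, a rotation by the angle $\tilde\zeta$ about some unit axis; $T$, $R_d$, $\tilde\zeta$ and the axis are functions of time. Let $U(x)=\int_0^x K_p\,s\,\frac{L^3\sin(s/L)}{\max\{L^3\sin(s/L),\mu\}}\,ds$ and $E(p,v)=\frac m2\|v\|^2+U(\operatorname{dist}(p,p_d))$, the energy of the undisturbed loop. Let $c<U(\pi L)$ (the energy at rest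 in the antipode $-p_d$), let $X=\{(p,v):\|p\|=L,\ E(p,v)\le c\}$, and let $T_{sup}>0$. Then there is $\tilde\zeta_{max}>0$ such that: 1. The outer loop is ISS with respect to $\tilde\zeta$, with restrictions $(p(0),\dot p(0))\in X$, $|\tilde\zeta|<\tilde\zeta_{max}$, $|T|\le T_{sup}$: there are $\beta$ of class $\mathcal{KL}$ and $\gamma$ of class $\mathcal K$ such that, for every solution on an interval $[0,\tau]$ that satisfies these restrictions (those on the inputs for almost every time) and every $t\in[0,\tau]$, the error $e(t)=\sqrt{\|p(t)-p_d\|^2+\|\dot p(t)\|^2}$ satisfies $$e(t)\le\beta(e(0),t)+\gamma\big(\operatorname{ess\,sup}_{[0,t]}|\tilde\zeta|\big).$$ 2. The asymptotic gain from $\tilde\zeta$ to the angular velocity $\omega_d$ of the desired attitude exists and is finite. Assume $T_p<mg$ in case $p_d=-L\hat z$. Then there is a number $\gamma_{out}\ge0$ such that the following holds for every constant yaw $\psi$. Let $T$ and $R_d$ be the ones commanded by the controller: with $F=K_p\operatorname{dist}(p,p_d)\hat t-K_d\dot p+mg\hat z+T_p\hat r$, let $T=\|F\|$ and let $R_d$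 be the rotation by $\psi$ about $\hat z$ followed by the minimal rotation that takes $\hat z$ to the direction of $F$ (the identity if $F$ is a multiple of $\hat z$). Then along every solution on $[0,\infty)$ that satisfies the restrictions of part 1, $\omega_d$, given by $\dot R_d=R_d\,\omega_d^\wedge$, exists at almost all sufficiently large times, and $$\limsup_{t\to\infty}\|\omega_d(t)\|\le\gamma_{out}\,\limsup_{t\to\infty}|\tilde\zeta(t)|\qquad\text{(essential upper limits)}.$$ -/

import Mathlib

open MeasureTheory Filter Topology Set
open scoped Quaternion Matrix

noncomputable section

namespace TetheredUAV

/-- Physical space, with the Euclidean norm. -/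
abbrev E3 := EuclideanSpace ℝ (Fin 3)

/-- Real 3 × 3 matrices. -/
abbrev Mat3 := Matrix (Fin 3) (Fin 3) ℝ

/-- The vertical unit vector of the inertial frame. -/
def zHat : E3 := EuclideanSpace.single 2 1

/-- The vector product of `ℝ³`. -/
def cross (x y : E3) : E3 := WithLp.toLp 2 (crossProduct x.ofLp y.ofLp)

/-- Matrix-vector product on `E3`. -/
def act (A : Mat3) (x : E3) : E3 := WithLp.toLp 2 (A *ᵥ x.ofLp)

/-- The skew operator `w ↦ w^∧`, so that `w^∧ x = w × x`. -/
def skew (w : E3) : Mat3 :=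
  !![0, -w 2, w 1;
     w 2, 0, -w 0;
     -w 1, w 0, 0]

/-- The imaginary part of a quaternion, as a vector. -/
def quatVec (q : ℍ[ℝ]) : E3 := !₂[q.imI, q.imJ, q.imK]

/-- The Euler-Rodrigues rotation matrix `I + 2 q₀ q_v^∧ + 2 (q_v^∧)²` of a unit quaternion. -/
def quatRot (q : ℍ[ℝ]) : Mat3 :=
  1 + (2 * q.re) • skew (quatVec q) + (2 : ℝ) • (skew (quatVec q) * skew (quatVec q))

/-- The quaternion `(cos (ζ/2), sin (ζ/2) a)` of the rotation of angle `ζ` about the axis `a`. -/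
def axisAngleQuat (ζ : ℝ) (a : E3) : ℍ[ℝ] :=
  ⟨Real.cos (ζ / 2), Real.sin (ζ / 2) * a 0, Real.sin (ζ / 2) * a 1, Real.sin (ζ / 2) * a 2⟩

/-- The constants of the vehicle, the cable and the outer-loop controller: mass, gravity, cable
length, normalisation threshold of the gradient, proportional and derivative gains, and the
constant pulling term. -/
structure Params where
  m : ℝ
  g : ℝ
  L : ℝ
  μ : ℝ
  Kp : ℝ
  Kd : ℝ
  Tp : ℝ
  m_pos : 0 < m
  g_pos : 0 < g
  L_pos : 0 < L
  μ_pos : 0 < μ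
  Kp_pos : 0 < Kp
  Kd_pos : 0 < Kd
  Tp_pos : 0 < Tp

/-- The great-circle distance on the sphere of radius `L`. -/
def gcDist (P : Params) (p pd : E3) : ℝ :=
  P.L * Real.arccos (inner ℝ (P.L⁻¹ • p) (P.L⁻¹ • pd))

/-- The gradient direction of the geodesic path from `p` to `pd`. -/
def tHat (P : Params) (pd p : E3) : E3 :=
  (max ‖cross (cross p pd) p‖ P.μ)⁻¹ • cross (cross p pd) p

/-- The geodesic PD law `T_t t̂`. -/
def pdForce (P : Params) (pd p v : E3) : E3 :=
  (gcDist P p pd * P.Kp) • tHat P pd p - P.Kd • v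

/-- The desired thrust vector `T R_d ẑ = T_t t̂ + m g ẑ + T_p r̂`. -/
def desiredThrust (P : Params) (pd p v : E3) : E3 :=
  pdForce P pd p v + (P.m * P.g) • zHat + P.Tp • (P.L⁻¹ • p)

open Classical in
/-- The quaternion of the minimal rotation that takes `ẑ` to the direction of `F`; the angle is
`arctan2 (√(F_x² + F_y²), F_z)`, and the identity is taken when `F` has no horizontal part. -/
def tiltQuat (F : E3) : ℍ[ℝ] :=
  let ρ := Real.sqrt (F 0 ^ 2 + F 1 ^ 2)
  let ζd := Complex.arg ⟨F 2, ρ⟩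
  if F 0 = 0 ∧ F 1 = 0 then 1
  else ⟨Real.cos (ζd / 2), Real.sin (ζd / 2) / ρ * -F 1, Real.sin (ζd / 2) / ρ * F 0, 0⟩

/-- The desired attitude `R_d`: a rotation of constant yaw `ψ` about `ẑ`, followed by the minimal
rotation onto the desired thrust direction. -/
def desiredAttitude (P : Params) (ψ : ℝ) (pd p v : E3) : Mat3 :=
  quatRot (tiltQuat (desiredThrust P pd p v) * axisAngleQuat ψ zHat)

/-- The disturbance `δ_ζ̃ = T R_d (R̃ᵀ - I) ẑ`, where `R̃` is the attitude error, the rotation of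
angle `ζ` about the axis `a`. -/
def disturbance (T : ℝ) (Rd : Mat3) (ζ : ℝ) (a : E3) : E3 :=
  T • act (Rd * ((quatRot (axisAngleQuat ζ a))ᵀ - 1)) zHat

/-- `(p, v)` is a (Carathéodory) solution on `[0, τ]` of the outer loop
`m p̈ = T_t t̂ + δ_ζ̃`, subject to `‖p‖ = L`: `v = ṗ` is absolutely continuous and the equation holds
almost everywhere, up to the reaction `lam • p` of the constraint, which is normal to the sphere.
The signals `T`, `Rd` and the error angle `ζ` and axis `a` are exogenous. -/
structure IsOuterSolution (P : Params) (pd : E3) (T : ℝ → ℝ) (Rd : ℝ → Mat3) (ζ : ℝ → ℝ)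
    (a p v : ℝ → E3) (τ : ℝ) : Prop where
  deriv_p : ∀ t ∈ Icc 0 τ, HasDerivWithinAt p (v t) (Icc 0 τ) t
  abs_cont_v : AbsolutelyContinuousOnInterval v 0 τ
  on_sphere : ∀ t ∈ Icc 0 τ, ‖p t‖ = P.L
  rotation : ∀ t ∈ Icc 0 τ, Rd t ∈ Matrix.specialOrthogonalGroup (Fin 3) ℝ
  unit_axis : ∀ t ∈ Icc 0 τ, ‖a t‖ = 1
  dynamics : ∀ᵐ t, t ∈ Icc 0 τ → ∃ v' : E3, HasDerivAt v v' t ∧ ∃ lam : ℝ,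
    P.m • v' = pdForce P pd (p t) (v t) + disturbance (T t) (Rd t) (ζ t) (a t) + lam • p t

/-- Potential of the proportional term as a function of the distance `x` to the desired position:
on the sphere `‖(p × pd) × p‖ = L³ sin (dist / L)`, so the term has size
`Kp s (L³ sin (s/L)) / max (L³ sin (s/L)) μ` at distance `s`. -/
def potential (P : Params) (x : ℝ) : ℝ :=
  ∫ s in (0 : ℝ)..x, P.Kp * s *
    (P.L ^ 3 * Real.sin (s / P.L) / max (P.L ^ 3 * Real.sin (s / P.L)) P.μ)

/-- Mechanical energy of the undisturbed outer loop, relative to the desired position. -/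
def energy (P : Params) (pd p v : E3) : ℝ :=
  P.m / 2 * ‖v‖ ^ 2 + potential P (gcDist P p pd)

/-- The energy of the undesired equilibrium, at rest in the antipode of the desired position. -/
def barrier (P : Params) : ℝ := potential P (Real.pi * P.L)

/-- Euclidean norm of the state `(p - pd, v)` relative to the equilibrium `(pd, 0)`. -/
def stateError (pd p v : E3) : ℝ := Real.sqrt (‖p - pd‖ ^ 2 + ‖v‖ ^ 2)

/-- Class `K` on `[0, ∞)`. -/
structure IsClassK (γ : ℝ → ℝ) : Prop where
  continuousOn : ContinuousOn γ (Ici 0)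
  strictMonoOn : StrictMonoOn γ (Ici 0)
  zero : γ 0 = 0

/-- Class `KL` on `[0, ∞) × [0, ∞)`. -/
structure IsClassKL (β : ℝ → ℝ → ℝ) : Prop where
  continuousOn : ContinuousOn (fun x : ℝ × ℝ => β x.1 x.2) (Ici 0 ×ˢ Ici 0)
  classK : ∀ t, 0 ≤ t → IsClassK (fun r => β r t)
  antitoneOn : ∀ r, 0 ≤ r → AntitoneOn (β r) (Ici 0)
  tendsto : ∀ r, 0 ≤ r → Tendsto (β r) atTop (𝓝 0)

/-- The outer loop is ISS with respect to `ζ̃`, with the restriction `X` on the initial state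
`(p 0, v 0)` and the restrictions `|ζ̃| < ζmax`, `|T| ≤ Tsup` on the inputs. Here `d` runs through
the essential bounds of `|ζ̃|` on `[0, t]`, i.e. through the numbers above its `L^∞` norm. -/
def ISSWithRestriction (P : Params) (pd : E3) (X : Set (E3 × E3)) (ζmax Tsup : ℝ) : Prop :=
  ∃ (β : ℝ → ℝ → ℝ) (γ : ℝ → ℝ), IsClassKL β ∧ IsClassK γ ∧
    ∀ (T : ℝ → ℝ) (Rd : ℝ → Mat3) (ζ : ℝ → ℝ) (a p v : ℝ → E3) (τ : ℝ), 0 < τ →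
      IsOuterSolution P pd T Rd ζ a p v τ →
      (p 0, v 0) ∈ X →
      (∀ᵐ s, s ∈ Icc 0 τ → |ζ s| < ζmax) →
      (∀ᵐ s, s ∈ Icc 0 τ → |T s| ≤ Tsup) →
      ∀ t ∈ Icc 0 τ, ∀ d : ℝ, 0 ≤ d → (∀ᵐ s, s ∈ Icc 0 t → |ζ s| ≤ d) →
        stateError pd (p t) (v t) ≤ β (stateError pd (p 0) (v 0)) t + γ d

/-- `γout` is an asymptotic gain from `ζ̃` to `ω_d` for the outer loop in which `T` and `R_d` are the
thrust and attitude commanded by the controller. Along each trajectory on `[0, ∞)` that meets the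
restrictions, the angular velocity `ω_d` of `R_d`, given by `Ṙ_d = R_d ω_d^∧`, exists at almost all
large times, and `limsup ‖ω_d‖ ≤ γout * limsup |ζ̃|` (essential upper limits at infinity). -/
def IsAsymptoticGain (P : Params) (ψ : ℝ) (pd : E3) (X : Set (E3 × E3)) (ζmax Tsup : ℝ)
    (γout : ℝ) : Prop :=
  ∀ (ζ : ℝ → ℝ) (a p v : ℝ → E3),
    (∀ τ, 0 < τ → IsOuterSolution P pd (fun t => ‖desiredThrust P pd (p t) (v t)‖)
      (fun t => desiredAttitude P ψ pd (p t) (v t)) ζ a p v τ) →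
    (p 0, v 0) ∈ X →
    (∀ᵐ s, 0 ≤ s → |ζ s| < ζmax) →
    (∀ᵐ s, 0 ≤ s → ‖desiredThrust P pd (p s) (v s)‖ ≤ Tsup) →
    ∃ (ωd : ℝ → E3) (t₀ : ℝ),
      (∀ᵐ t, t₀ ≤ t → ∀ i j, HasDerivAt (fun s => desiredAttitude P ψ pd (p s) (v s) i j)
        ((desiredAttitude P ψ pd (p t) (v t) * skew (ωd t)) i j) t) ∧
      ∀ d : ℝ, 0 ≤ d → (∃ t₁, ∀ᵐ s, t₁ ≤ s → |ζ s| ≤ d) →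
        ∀ ε : ℝ, 0 < ε → ∃ t₂, ∀ᵐ s, t₂ ≤ s → ‖ωd s‖ ≤ γout * d + ε

end TetheredUAV

end

/-! Everything is expressed through y = `cosAngle`, N = 1 - y (of the order of the squared distance
near `pd`) and the velocity. Tangentially the proportional force is L² φ(y) (pd - y p) with φ =
`pdGain`. Because of the threshold μ it is quadratic in the distance near `pd`: its size is O(N),
and the potential is only of order N^(3/2). The linearisation has no stiffness, so a standard
quadratic Lyapunov function is not available.

Part 1. The energy dissipates only through the damping. Subtracting ε m N ⟨v, pd⟩ yields a strict
Lyapunov function V; the weight N keeps the cross term dominated by the weak potential. Its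
derivative contains -a ‖v‖² - b N³ (1 + y) (`dissipation_inequality`). The factor 1 + y vanishes
only at the antipode, which the level below the barrier excludes (`exists_barrier_margin`). As V ≤ A
(‖v‖² + N) and the speed is bounded, the dissipation dominates V³ (`cube_le_dissipation`), so V' ≤
-k V³ + C |ζ̃| on a sublevel set, which is invariant for small ζ̃. Comparison with u' = -k u³ gives
V ≤ u + (C d / k)^(1/3) (`LyapunovCertificate.le_decay_add_gain`), and e⁴ ≤ K V turns this into ISS.

Part 2. This ISS gain is not linear, but ω_d depends on the state through quantities of order ‖v‖, N
and ‖δ‖ only, and ‖v‖ and N have linear gain. Indeed the force is O(N), so the damping makes ‖v‖ at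
most of order N + ‖δ‖, while the slow variable Kd L² N - m ⟨v, pd⟩ decreases at rate σ³, σ = √(1 -
y²), against a disturbance term σ ‖δ‖; hence N ≲ σ² is ultimately O(‖δ‖)
(`exists_linear_ultimate_bound`). The thrust vector F then has rate O(‖v‖ + N + ‖δ‖), and the
commanded attitude is a C¹ function of F away from the downward directions
(`exists_angularVelocity_bound`), where the equilibrium thrust does not lie
(`equilibriumThrust_tilt_pos`). -/

noncomputable section

/-! ### Absolutely continuous functions and differential inequalities almost everywhere -/

namespace AbsolutelyContinuousOnInterval

/-- The sums of increments of `h` over disjoint intervals are squeezed by those of `f` and `g`.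
Composition with Lipschitz maps, maxima and clamping are all instances. -/
theorem of_dist_le {X Y Z : Type*} [PseudoMetricSpace X] [PseudoMetricSpace Y]
    [PseudoMetricSpace Z] {f : ℝ → X} {g : ℝ → Y} {h : ℝ → Z} {a b K : ℝ}
    (hf : AbsolutelyContinuousOnInterval f a b) (hg : AbsolutelyContinuousOnInterval g a b)
    (hh : ∀ x ∈ uIcc a b, ∀ y ∈ uIcc a b,
      dist (h x) (h y) ≤ K * (dist (f x) (f y) + dist (g x) (g y))) :
    AbsolutelyContinuousOnInterval h a b := by
  have hlim := (Tendsto.add hf hg).const_mul K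
  rw [add_zero, mul_zero] at hlim
  refine squeeze_zero' (Eventually.of_forall fun t => Finset.sum_nonneg fun i _ => dist_nonneg)
    ?_ hlim
  have hmem : ∀ᶠ E in (totalLengthFilter ⊓ 𝓟 (disjWithin a b)), E ∈ disjWithin a b :=
    mem_inf_of_right (mem_principal_self _)
  filter_upwards [hmem] with E hE
  rw [← Finset.sum_add_distrib, Finset.mul_sum]
  exact Finset.sum_le_sum fun i hi => hh _ (hE.1 i hi).1 _ (hE.1 i hi).2

theorem comp_lipschitz {X Y : Type*} [PseudoMetricSpace X] [PseudoMetricSpace Y] {f : ℝ → X}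
    {g : X → Y} {K : NNReal} {a b : ℝ} (hg : LipschitzWith K g)
    (hf : AbsolutelyContinuousOnInterval f a b) :
    AbsolutelyContinuousOnInterval (fun t => g (f t)) a b :=
  of_dist_le (K := K) hf hf fun x _ y _ => (hg.dist_le_mul _ _).trans (by
    gcongr; linarith [dist_nonneg (x := f x) (y := f y)])

theorem max {f g : ℝ → ℝ} {a b : ℝ} (hf : AbsolutelyContinuousOnInterval f a b)
    (hg : AbsolutelyContinuousOnInterval g a b) :
    AbsolutelyContinuousOnInterval (fun t => max (f t) (g t)) a b :=
  of_dist_le (K := 1) hf hg fun x _ y _ => by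
    rw [Real.dist_eq, Real.dist_eq, Real.dist_eq, one_mul]
    refine (abs_max_sub_max_le_max _ _ _ _).trans (max_le ?_ ?_)
    · linarith [abs_nonneg (g x - g y)]
    · linarith [abs_nonneg (f x - f y)]

theorem of_hasDerivWithinAt {E : Type*} [NormedAddCommGroup E] [NormedSpace ℝ E] {f f' : ℝ → E}
    {a b C : ℝ} (hab : a ≤ b) (hf : ∀ t ∈ Icc a b, HasDerivWithinAt f (f' t) (Icc a b) t)
    (hC : ∀ t ∈ Icc a b, ‖f' t‖ ≤ C) : AbsolutelyContinuousOnInterval f a b := by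
  refine LipschitzOnWith.absolutelyContinuousOnInterval (K := C.toNNReal) ?_
  rw [uIcc_of_le hab]
  refine (convex_Icc a b).lipschitzOnWith_of_nnnorm_hasDerivWithin_le hf fun t ht => ?_
  rw [← NNReal.coe_le_coe, coe_nnnorm]
  exact (hC t ht).trans (Real.le_coe_toNNReal C)

/-- A level that an absolutely continuous function cannot cross upwards. -/
theorem le_of_ae_deriv_nonpos {f : ℝ → ℝ} {a b c₀ c₁ : ℝ} (hab : a ≤ b)
    (hf : AbsolutelyContinuousOnInterval f a b) (h0 : f a ≤ c₀) (h01 : c₀ < c₁)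
    (h : ∀ᵐ t, t ∈ Icc a b → c₀ < f t → f t < c₁ → ∃ f', HasDerivAt f f' t ∧ f' ≤ 0) :
    ∀ t ∈ Icc a b, f t ≤ c₀ := by
  intro t ht
  -- Clamp `f` to [c₀, c₁]. Where `f` is outside the open band, `g` has a global extremum, so `deriv
  -- g` is 0 whether or not `f` is differentiable there; inside the band the hypothesis applies.
  set g : ℝ → ℝ := fun t => Max.max c₀ (min (f t) c₁) with hg
  have hgac : AbsolutelyContinuousOnInterval g a b :=
    of_dist_le (K := 1) hf hf fun x _ y _ => by
      rw [Real.dist_eq, Real.dist_eq, one_mul]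
      refine (abs_max_sub_max_le_max _ _ _ _).trans (max_le ?_ ?_)
      · simp only [sub_self, abs_zero]; positivity
      · refine (abs_min_sub_min_le_max _ _ _ _).trans (max_le ?_ ?_)
        · linarith [abs_nonneg (f x - f y)]
        · simp only [sub_self, abs_zero]; positivity
  have hder : ∀ᵐ s, s ∈ Icc a b → deriv g s ≤ 0 := by
    filter_upwards [h] with s hs hsI
    rcases le_or_gt (f s) c₀ with h1 | h1
    · have : IsLocalMin g s := Eventually.of_forall fun x => by
        have : g s = c₀ := by simp only [hg]; exact max_eq_left ((min_le_left _ _).trans h1)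
        rw [this]; exact le_max_left _ _
      exact this.deriv_eq_zero.le
    rcases lt_or_ge (f s) c₁ with h2 | h2
    · obtain ⟨f', hf', hle⟩ := hs hsI h1 h2
      have hev : g =ᶠ[𝓝 s] f := by
        filter_upwards [hf'.continuousAt.eventually (lt_mem_nhds h1),
          hf'.continuousAt.eventually (gt_mem_nhds h2)] with x hx1 hx2
        simp only [hg]
        rw [min_eq_left hx2.le, max_eq_right hx1.le]
      rw [hev.deriv_eq, hf'.deriv]; exact hle
    · have : IsLocalMax g s := Eventually.of_forall fun x => by
        have : g s = c₁ := by simp only [hg]; rw [min_eq_right h2, max_eq_right h01.le]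
        rw [this]; exact max_le h01.le (min_le_right _ _)
      exact this.deriv_eq_zero.le
  have hsub : uIcc a t ⊆ uIcc a b := by
    rw [uIcc_of_le hab, uIcc_of_le ht.1]; exact Icc_subset_Icc_right ht.2
  have hint := (hgac.mono hsub).integral_deriv_eq_sub
  have hneg : 0 ≤ ∫ x in a..t, -deriv g x := by
    refine intervalIntegral.integral_nonneg_of_ae_restrict ht.1 ?_
    rw [EventuallyLE, ae_restrict_iff' measurableSet_Icc]
    filter_upwards [hder] with s hs hsI
    have := hs ⟨hsI.1, hsI.2.trans ht.2⟩
    simp only [Pi.zero_apply]; linarith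
  rw [intervalIntegral.integral_neg] at hneg
  have hga : g a = c₀ := max_eq_left ((min_le_left _ _).trans h0)
  have hgt : g t ≤ c₀ := by linarith
  have : min (f t) c₁ ≤ c₀ := (le_max_right _ _).trans hgt
  rcases min_le_iff.1 this with h | h
  · exact h
  · linarith

/-- A function bounded below which decreases at a definite rate above a level is eventually
below that level. -/
theorem eventually_le_of_ae_deriv_le {f : ℝ → ℝ} {t₀ B c η : ℝ} (hη : 0 < η)
    (hf : ∀ τ, t₀ ≤ τ → AbsolutelyContinuousOnInterval f t₀ τ) (hB : ∀ t, t₀ ≤ t → B ≤ f t)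
    (h : ∀ᵐ t, t₀ ≤ t → c < f t → ∃ f', HasDerivAt f f' t ∧ f' ≤ -η) :
    ∃ t₁, t₀ ≤ t₁ ∧ ∀ t, t₁ ≤ t → f t ≤ c := by
  have hex : ∃ t₁, t₀ ≤ t₁ ∧ f t₁ ≤ c := by
    by_contra! hcon
    -- Long enough for decrease at rate η to bring `f` below its lower bound B.
    set τ := t₀ + (|f t₀ - B| + 1) / η with hτ
    have hle : t₀ ≤ τ := by
      have : 0 ≤ (|f t₀ - B| + 1) / η := by positivity
      linarith
    have hlin : AbsolutelyContinuousOnInterval (fun t : ℝ => η * (t - t₀)) t₀ τ := by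
      refine of_hasDerivWithinAt (f' := fun _ => η) (C := |η|) hle (fun t _ => ?_)
        fun t _ => le_of_eq (Real.norm_eq_abs η)
      simpa using (((hasDerivAt_id t).sub_const t₀).const_mul η).hasDerivWithinAt
    have := le_of_ae_deriv_nonpos (f := fun t => f t + η * (t - t₀)) (c₀ := f t₀)
      (c₁ := f t₀ + 1) hle ((hf τ hle).fun_add hlin) (by simp) (by linarith) (by
        filter_upwards [h] with t ht htI _ _
        obtain ⟨f', hf', hle'⟩ := ht htI.1 (hcon t htI.1)
        refine ⟨f' + η, ?_, by linarith⟩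
        have h2 := ((hasDerivAt_id t).sub_const t₀).const_mul η
        simp only [mul_one] at h2
        exact hf'.add h2) τ ⟨hle, le_rfl⟩
    have hB' := hB τ hle
    have : η * (τ - t₀) = |f t₀ - B| + 1 := by
      rw [hτ]; field_simp; ring
    simp only [this] at *
    linarith [le_abs_self (f t₀ - B)]
  obtain ⟨t₁, h1, hft⟩ := hex
  refine ⟨t₁, h1, fun t ht => ?_⟩
  refine le_of_ae_deriv_nonpos (c₁ := c + 1) ht ((hf t (h1.trans ht)).mono ?_) hft (by linarith) ?_
    t ⟨ht, le_rfl⟩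
  · rw [uIcc_of_le ht, uIcc_of_le (h1.trans ht)]; exact Icc_subset_Icc_left h1
  · filter_upwards [h] with s hs hsI h2 _
    obtain ⟨f', hf', hle'⟩ := hs (h1.trans hsI.1) h2
    exact ⟨f', hf', by linarith⟩

end AbsolutelyContinuousOnInterval

namespace TetheredUAV

/-! ### Vector algebra and the size of the disturbance -/

theorem inner_eq_sum (x y : E3) : inner ℝ x y = x 0 * y 0 + x 1 * y 1 + x 2 * y 2 := by
  simp [PiLp.inner_apply, Fin.sum_univ_three, mul_comm]

theorem norm_sq_eq_sum (x : E3) : ‖x‖ ^ 2 = x 0 ^ 2 + x 1 ^ 2 + x 2 ^ 2 := by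
  rw [← real_inner_self_eq_norm_sq, inner_eq_sum]; ring

theorem cross_cross_self (p w : E3) :
    cross (cross p w) p = ‖p‖ ^ 2 • w - (inner ℝ p w : ℝ) • p := by
  rw [norm_sq_eq_sum, inner_eq_sum]
  ext i
  fin_cases i <;> simp [cross, cross_apply] <;> ring

theorem norm_act_of_mem_specialOrthogonalGroup {A : Mat3}
    (hA : A ∈ Matrix.specialOrthogonalGroup (Fin 3) ℝ) (x : E3) : ‖act A x‖ = ‖x‖ := by
  have h1 : Aᵀ * A = 1 := by
    have := (Matrix.mem_specialOrthogonalGroup_iff.1 hA).1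
    exact (Matrix.mem_orthogonalGroup_iff' (Fin 3) ℝ).1 this
  have h2 : ‖act A x‖ ^ 2 = ‖x‖ ^ 2 := by
    rw [EuclideanSpace.real_norm_sq_eq, EuclideanSpace.real_norm_sq_eq]
    have h3 : ∀ w : Fin 3 → ℝ, ∑ i, w i ^ 2 = w ⬝ᵥ w := fun w => by
      simp [dotProduct, sq]
    change ∑ i, (A *ᵥ x.ofLp) i ^ 2 = ∑ i, x.ofLp i ^ 2
    rw [h3, h3, Matrix.dotProduct_mulVec, Matrix.vecMul_mulVec, h1, Matrix.vecMul_one]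
  exact (pow_left_inj₀ (norm_nonneg _) (norm_nonneg _) two_ne_zero).1 h2

/-- Only the horizontal part of the axis moves ẑ: the squared displacement is 4 sin²(ζ/2) (a₀² +
a₁²), at most 4 (ζ/2)². -/
theorem norm_act_transpose_sub_one_zHat_le (ζ : ℝ) {a : E3} (ha : ‖a‖ = 1) :
    ‖act ((quatRot (axisAngleQuat ζ a))ᵀ - 1) zHat‖ ≤ |ζ| := by
  have ha2 : a 0 ^ 2 + a 1 ^ 2 + a 2 ^ 2 = 1 := by rw [← norm_sq_eq_sum, ha, one_pow]
  have hcs := Real.sin_sq_add_cos_sq (ζ / 2)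
  have h1 : ‖act ((quatRot (axisAngleQuat ζ a))ᵀ - 1) zHat‖ ^ 2
      = 4 * Real.sin (ζ / 2) ^ 2 * (a 0 ^ 2 + a 1 ^ 2) := by
    rw [norm_sq_eq_sum]
    simp only [act, quatRot, axisAngleQuat, quatVec, skew, zHat, Matrix.mulVec, dotProduct,
      Fin.sum_univ_three, Matrix.sub_apply, Matrix.transpose_apply, Matrix.add_apply,
      Matrix.smul_apply, Matrix.mul_apply, Matrix.one_apply]
    simp
    generalize Real.sin (ζ / 2) = s at *
    generalize Real.cos (ζ / 2) = c at *
    have hc : c ^ 2 = 1 - s ^ 2 := by linarith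
    have h2 : a 2 ^ 2 = 1 - a 0 ^ 2 - a 1 ^ 2 := by linarith
    linear_combination (4 * s ^ 2 * (a 0 ^ 2 + a 1 ^ 2)) * hc
      + (4 * s ^ 4 * (a 0 ^ 2 + a 1 ^ 2)) * h2
  have h2 : ‖act ((quatRot (axisAngleQuat ζ a))ᵀ - 1) zHat‖ ^ 2 ≤ |ζ| ^ 2 := by
    rw [h1, sq_abs]
    have hs : |Real.sin (ζ / 2)| ≤ |ζ / 2| := Real.abs_sin_le_abs
    have hs2 : Real.sin (ζ / 2) ^ 2 ≤ (ζ / 2) ^ 2 := sq_le_sq.2 hs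
    nlinarith [sq_nonneg (a 2), sq_nonneg (Real.sin (ζ / 2))]
  exact le_of_sq_le_sq h2 (abs_nonneg _)

theorem act_mul (A B : Mat3) (x : E3) : act (A * B) x = act A (act B x) := by
  simp [act, Matrix.mulVec_mulVec]

theorem norm_disturbance_le (T : ℝ) {Rd : Mat3}
    (hR : Rd ∈ Matrix.specialOrthogonalGroup (Fin 3) ℝ) (ζ : ℝ) {a : E3} (ha : ‖a‖ = 1) :
    ‖disturbance T Rd ζ a‖ ≤ |T| * |ζ| := by
  rw [disturbance, norm_smul, Real.norm_eq_abs, act_mul,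
    norm_act_of_mem_specialOrthogonalGroup hR]
  exact mul_le_mul_of_nonneg_left (norm_act_transpose_sub_one_zHat_le ζ ha) (abs_nonneg T)

/-! ### The sphere in terms of the cosine of the angle -/

/-- Cosine of the angle between a position and the desired position. -/
def cosAngle (P : Params) (pd p : E3) : ℝ := inner ℝ p pd / P.L ^ 2

/-- The factor in front of the gradient direction in the proportional force, as a function of the
cosine of the angle. -/
def pdGain (P : Params) (y : ℝ) : ℝ :=
  P.Kp * P.L * Real.arccos y / max (P.L ^ 3 * √(1 - y ^ 2)) P.μ

/-- The potential as a function of the cosine of the angle. -/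
def cosPotential (P : Params) (y : ℝ) : ℝ := ∫ s in y..1, P.L ^ 4 * pdGain P s

/-- A lower slope of `pdGain`. -/
def gainSlope (P : Params) : ℝ := P.Kp * P.L / max (P.L ^ 3) P.μ

section geometry
variable {P : Params} {pd p v : E3}

theorem inner_eq_cosAngle (P : Params) (pd p : E3) : inner ℝ p pd = P.L ^ 2 * cosAngle P pd p := by
  have := P.L_pos.ne'
  rw [cosAngle]; field_simp

theorem abs_cosAngle_le (hpd : ‖pd‖ = P.L) (hp : ‖p‖ = P.L) : |cosAngle P pd p| ≤ 1 := by
  have hL := P.L_pos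
  rw [cosAngle, abs_div, abs_of_pos (pow_pos hL 2), div_le_one (pow_pos hL 2)]
  calc |inner ℝ p pd| ≤ ‖p‖ * ‖pd‖ := abs_real_inner_le_norm _ _
    _ = P.L ^ 2 := by rw [hp, hpd]; ring

theorem gcDist_eq (P : Params) (pd p : E3) :
    gcDist P p pd = P.L * Real.arccos (cosAngle P pd p) := by
  have hL := P.L_pos.ne'
  rw [gcDist, cosAngle, real_inner_smul_left, real_inner_smul_right]
  congr 2; field_simp

theorem cross_cross_eq (hp : ‖p‖ = P.L) :
    cross (cross p pd) p = P.L ^ 2 • (pd - cosAngle P pd p • p) := by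
  rw [cross_cross_self, hp, inner_eq_cosAngle P, smul_sub, smul_smul]

theorem norm_sub_cosAngle_smul (hpd : ‖pd‖ = P.L) (hp : ‖p‖ = P.L) :
    ‖pd - cosAngle P pd p • p‖ = P.L * √(1 - cosAngle P pd p ^ 2) := by
  have hL := P.L_pos
  have hy := abs_cosAngle_le hpd hp
  have h1 : 0 ≤ 1 - cosAngle P pd p ^ 2 := by
    have := (sq_le_one_iff_abs_le_one _).2 hy; linarith
  rw [← pow_left_inj₀ (norm_nonneg _) (by positivity) two_ne_zero, mul_pow, Real.sq_sqrt h1,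
    norm_sub_sq_real, real_inner_smul_right, real_inner_comm, inner_eq_cosAngle P, norm_smul,
    hp, hpd, Real.norm_eq_abs, mul_pow, sq_abs]
  ring

theorem norm_cross_cross (hpd : ‖pd‖ = P.L) (hp : ‖p‖ = P.L) :
    ‖cross (cross p pd) p‖ = P.L ^ 3 * √(1 - cosAngle P pd p ^ 2) := by
  have hL := P.L_pos
  rw [cross_cross_eq hp, norm_smul, norm_sub_cosAngle_smul hpd hp, Real.norm_eq_abs,
    abs_of_pos (by positivity)]
  ring

theorem pdForce_eq (hpd : ‖pd‖ = P.L) (hp : ‖p‖ = P.L) :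
    pdForce P pd p v =
      (P.L ^ 2 * pdGain P (cosAngle P pd p)) • (pd - cosAngle P pd p • p) - P.Kd • v := by
  rw [pdForce, tHat, norm_cross_cross hpd hp, cross_cross_eq hp, gcDist_eq, smul_smul, smul_smul,
    pdGain]
  congr 2
  ring

theorem stateError_sq (hpd : ‖pd‖ = P.L) (hp : ‖p‖ = P.L) :
    stateError pd p v ^ 2 = 2 * P.L ^ 2 * (1 - cosAngle P pd p) + ‖v‖ ^ 2 := by
  rw [stateError, Real.sq_sqrt (by positivity), norm_sub_sq_real, hp, hpd, inner_eq_cosAngle P]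
  ring

end geometry

/-! ### Bounds for the proportional gain and the potential -/

section gain
variable (P : Params) {y : ℝ}

theorem continuous_pdGain : Continuous (pdGain P) := by
  unfold pdGain
  refine Continuous.div (by fun_prop) (by fun_prop) fun y => ?_
  exact (lt_of_lt_of_le P.μ_pos (le_max_right _ _)).ne'

theorem pdGain_nonneg (y : ℝ) : 0 ≤ pdGain P y :=
  div_nonneg (mul_nonneg (mul_pos P.Kp_pos P.L_pos).le (Real.arccos_nonneg y))
    (P.μ_pos.le.trans (le_max_right _ _))

theorem pdGain_le_arccos (y : ℝ) : pdGain P y ≤ P.Kp * P.L / P.μ * Real.arccos y := by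
  have := P.μ_pos
  have h : 0 ≤ P.Kp * P.L * Real.arccos y :=
    mul_nonneg (mul_pos P.Kp_pos P.L_pos).le (Real.arccos_nonneg y)
  rw [pdGain, div_mul_eq_mul_div]
  gcongr
  exact le_max_right _ _

theorem pdGain_le (y : ℝ) : pdGain P y ≤ P.Kp * P.L / P.μ * Real.pi :=
  (pdGain_le_arccos P y).trans (mul_le_mul_of_nonneg_left (Real.arccos_le_pi y)
    (div_pos (mul_pos P.Kp_pos P.L_pos) P.μ_pos).le)

theorem gainSlope_pos : 0 < gainSlope P :=
  div_pos (mul_pos P.Kp_pos P.L_pos) (lt_of_lt_of_le P.μ_pos (le_max_right _ _))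

theorem gainSlope_mul_arccos_le (y : ℝ) : gainSlope P * Real.arccos y ≤ pdGain P y := by
  have hμ := P.μ_pos
  have hL := P.L_pos
  have h : 0 ≤ P.Kp * P.L * Real.arccos y :=
    mul_nonneg (mul_pos P.Kp_pos P.L_pos).le (Real.arccos_nonneg y)
  rw [pdGain, gainSlope, div_mul_eq_mul_div]
  refine div_le_div_of_nonneg_left h (lt_of_lt_of_le hμ (le_max_right _ _))
    (max_le_max_right _ ?_)
  have : √(1 - y ^ 2) ≤ 1 := Real.sqrt_le_one.2 (by nlinarith [sq_nonneg y])
  nlinarith [pow_pos hL 3]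

theorem sqrt_one_sub_sq_le_arccos (y : ℝ) : √(1 - y ^ 2) ≤ Real.arccos y := by
  rw [← Real.sin_arccos]; exact Real.sin_le (Real.arccos_nonneg y)

theorem one_sub_le_arccos (hy : |y| ≤ 1) : 1 - y ≤ Real.arccos y := by
  have hy' := abs_le.1 hy
  have h := Real.one_sub_sq_div_two_le_cos (x := Real.arccos y)
  rw [Real.cos_arccos hy'.1 hy'.2] at h
  have h0 := Real.arccos_nonneg y
  rcases le_or_gt (Real.arccos y) 2 with h2 | h2
  · nlinarith
  · linarith

theorem arccos_sq_le (hy : |y| ≤ 1) : Real.arccos y ^ 2 ≤ Real.pi ^ 2 / 2 * (1 - y) := by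
  have hy' := abs_le.1 hy
  have h := Real.cos_le_one_sub_mul_cos_sq (x := Real.arccos y)
    (by rw [abs_of_nonneg (Real.arccos_nonneg y)]; exact Real.arccos_le_pi y)
  rw [Real.cos_arccos hy'.1 hy'.2] at h
  have hpi := Real.pi_pos
  have h2 : 2 / Real.pi ^ 2 * Real.arccos y ^ 2 ≤ 1 - y := by linarith
  rw [div_mul_eq_mul_div, div_le_iff₀ (by positivity)] at h2
  linarith

theorem gainSlope_mul_one_sub_le (hy : |y| ≤ 1) : gainSlope P * (1 - y) ≤ pdGain P y :=
  (mul_le_mul_of_nonneg_left (one_sub_le_arccos hy) (gainSlope_pos P).le).trans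
    (gainSlope_mul_arccos_le P y)

theorem gainSlope_mul_sqrt_le (y : ℝ) : gainSlope P * √(1 - y ^ 2) ≤ pdGain P y :=
  (mul_le_mul_of_nonneg_left (sqrt_one_sub_sq_le_arccos y) (gainSlope_pos P).le).trans
    (gainSlope_mul_arccos_le P y)

/-- Both `pdGain` and √(1 - y²) are at most of the order of arccos y, and arccos² is of the order of
1 - y. This is the quadratic smallness of the proportional force near `pd`. -/
theorem pdGain_mul_sqrt_le (hy : |y| ≤ 1) :
    pdGain P y * √(1 - y ^ 2) ≤ P.Kp * P.L / P.μ * (Real.pi ^ 2 / 2) * (1 - y) := by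
  have h0 := Real.arccos_nonneg y
  have hc : 0 < P.Kp * P.L / P.μ := div_pos (mul_pos P.Kp_pos P.L_pos) P.μ_pos
  calc pdGain P y * √(1 - y ^ 2)
      ≤ (P.Kp * P.L / P.μ * Real.arccos y) * Real.arccos y := by
        gcongr
        · exact pdGain_le_arccos P y
        · exact sqrt_one_sub_sq_le_arccos y
    _ = P.Kp * P.L / P.μ * Real.arccos y ^ 2 := by ring
    _ ≤ P.Kp * P.L / P.μ * (Real.pi ^ 2 / 2 * (1 - y)) := by
        gcongr; exact arccos_sq_le hy
    _ = _ := by ring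

/-- The factor L⁴ matches the power L² φ ⟨v, pd⟩ of the proportional force with y' = ⟨v, pd⟩ / L²,
so that the two cancel in the energy balance. -/
theorem hasDerivAt_cosPotential (y : ℝ) :
    HasDerivAt (cosPotential P) (-(P.L ^ 4 * pdGain P y)) y := by
  have hc : Continuous fun s => P.L ^ 4 * pdGain P s := continuous_const.mul (continuous_pdGain P)
  exact intervalIntegral.integral_hasDerivAt_left (hc.intervalIntegrable _ _)
    (hc.stronglyMeasurableAtFilter _ _) hc.continuousAt

theorem cosPotential_one : cosPotential P 1 = 0 := intervalIntegral.integral_same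

theorem continuous_cosPotential : Continuous (cosPotential P) :=
  continuous_iff_continuousAt.2 fun y => (hasDerivAt_cosPotential P y).continuousAt

theorem lipschitzWith_cosPotential :
    LipschitzWith (P.L ^ 4 * (P.Kp * P.L / P.μ * Real.pi)).toNNReal (cosPotential P) := by
  refine lipschitzWith_of_nnnorm_deriv_le
    (fun y => (hasDerivAt_cosPotential P y).differentiableAt) fun y => ?_
  rw [← NNReal.coe_le_coe, coe_nnnorm, (hasDerivAt_cosPotential P y).deriv, norm_neg,
    Real.norm_of_nonneg (mul_nonneg (pow_pos P.L_pos 4).le (pdGain_nonneg P y))]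
  exact (mul_le_mul_of_nonneg_left (pdGain_le P y) (pow_pos P.L_pos 4).le).trans
    (Real.le_coe_toNNReal _)

theorem cosPotential_le (hy : |y| ≤ 1) :
    cosPotential P y ≤ P.L ^ 4 * (P.Kp * P.L / P.μ * Real.pi) * (1 - y) := by
  have hc : Continuous fun s => P.L ^ 4 * pdGain P s := continuous_const.mul (continuous_pdGain P)
  have := intervalIntegral.integral_mono_on (μ := volume) (abs_le.1 hy).2
    (hc.intervalIntegrable _ _)
    (intervalIntegrable_const (c := P.L ^ 4 * (P.Kp * P.L / P.μ * Real.pi)))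
    (fun x _ => mul_le_mul_of_nonneg_left (pdGain_le P x) (pow_pos P.L_pos 4).le)
  rw [intervalIntegral.integral_const, smul_eq_mul] at this
  rw [cosPotential]; linarith

/-- Integrates the lower slope of the gain. The true order at y = 1 is 3/2; the square is weaker but
holds on all of [-1, 1] and suffices to absorb the cross term. -/
theorem le_cosPotential (hy : |y| ≤ 1) :
    P.L ^ 4 * gainSlope P / 2 * (1 - y) ^ 2 ≤ cosPotential P y := by
  have hc : Continuous fun s => P.L ^ 4 * pdGain P s := continuous_const.mul (continuous_pdGain P)
  have hy' := abs_le.1 hy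
  have hd : Continuous fun s : ℝ => P.L ^ 4 * (gainSlope P * (1 - s)) := by fun_prop
  have := intervalIntegral.integral_mono_on (μ := volume) hy'.2
    (hd.intervalIntegrable _ _) (hc.intervalIntegrable _ _)
    (fun x hx => mul_le_mul_of_nonneg_left
      (gainSlope_mul_one_sub_le P (abs_le.2 ⟨hy'.1.trans hx.1, hx.2⟩)) (pow_pos P.L_pos 4).le)
  rw [cosPotential]
  refine le_trans (le_of_eq ?_) this
  rw [intervalIntegral.integral_eq_sub_of_hasDerivAt
    (f := fun s => -(P.L ^ 4 * gainSlope P / 2 * (1 - s) ^ 2)) ?_ (hd.intervalIntegrable _ _)]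
  · ring
  · intro x _
    have h1 := ((((hasDerivAt_id x).const_sub 1).pow 2).const_mul
      (P.L ^ 4 * gainSlope P / 2)).neg
    convert! h1 using 1
    simp; ring

/-- Substitution y = cos (s / L): on [0, πL] the angle s / L lies in [0, π], where arccos inverts
cos and √(1 - cos²) = sin. -/
theorem potential_eq_cosPotential {x : ℝ} (hx0 : 0 ≤ x) (hx : x ≤ Real.pi * P.L) :
    potential P x = cosPotential P (Real.cos (x / P.L)) := by
  have hL := P.L_pos
  have hcont : Continuous fun s => P.Kp * s *
      (P.L ^ 3 * Real.sin (s / P.L) / max (P.L ^ 3 * Real.sin (s / P.L)) P.μ) := by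
    refine Continuous.mul (by fun_prop) (Continuous.div (by fun_prop) (by fun_prop) fun s => ?_)
    exact (lt_of_lt_of_le P.μ_pos (le_max_right _ _)).ne'
  rw [potential, intervalIntegral.integral_eq_sub_of_hasDerivAt
    (f := fun s => cosPotential P (Real.cos (s / P.L))) ?_ (hcont.intervalIntegrable _ _)]
  · simp [cosPotential_one]
  · intro s hs
    rw [uIcc_of_le hx0] at hs
    have h0 : 0 ≤ s / P.L := div_nonneg hs.1 hL.le
    have hpi : s / P.L ≤ Real.pi := by rw [div_le_iff₀ hL]; exact hs.2.trans hx
    have hd := (hasDerivAt_cosPotential P (Real.cos (s / P.L))).comp s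
      (((hasDerivAt_id s).div_const P.L).cos)
    convert! hd using 1
    have hsin : √(1 - Real.cos (s / P.L) ^ 2) = Real.sin (s / P.L) := by
      rw [← Real.sin_sq, Real.sqrt_sq (Real.sin_nonneg_of_nonneg_of_le_pi h0 hpi)]
    simp only [pdGain, id, Real.arccos_cos h0 hpi, hsin]
    field_simp

end gain

theorem potential_gcDist (P : Params) (pd p : E3) (hpd : ‖pd‖ = P.L) (hp : ‖p‖ = P.L) :
    potential P (gcDist P p pd) = cosPotential P (cosAngle P pd p) := by
  have hL := P.L_pos
  have hy := abs_le.1 (abs_cosAngle_le hpd hp)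
  rw [gcDist_eq, potential_eq_cosPotential P (mul_nonneg hL.le (Real.arccos_nonneg _))
    (by nlinarith [Real.arccos_le_pi (cosAngle P pd p)]), mul_div_cancel_left₀ _ hL.ne',
    Real.cos_arccos hy.1 hy.2]

theorem barrier_eq (P : Params) : barrier P = cosPotential P (-1) := by
  have hL := P.L_pos
  rw [barrier, potential_eq_cosPotential P (by positivity) le_rfl, mul_div_cancel_right₀ _ hL.ne',
    Real.cos_pi]

/-! ### Dynamics on the sphere with the reaction eliminated -/

/-- At time `t` the trajectory `(p, v)` on the sphere has acceleration `w`, under the disturbance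
`δ`; the reaction of the constraint is eliminated. -/
structure HasAcceleration (P : Params) (pd δ : E3) (p v : ℝ → E3) (w : E3) (t : ℝ) : Prop where
  deriv_p : HasDerivAt p (v t) t
  deriv_v : HasDerivAt v w t
  norm_p : ‖p t‖ = P.L
  tangent : inner ℝ (p t) (v t) = (0 : ℝ)
  dynamics : P.m • w =
    (P.L ^ 2 * pdGain P (cosAngle P pd (p t))) • (pd - cosAngle P pd (p t) • p t) - P.Kd • v t
      + δ - ((P.m * ‖v t‖ ^ 2 + inner ℝ δ (p t)) / P.L ^ 2) • p t

section
variable {P : Params} {pd : E3} {T : ℝ → ℝ} {Rd : ℝ → Mat3} {ζ : ℝ → ℝ} {a p v : ℝ → E3} {τ : ℝ}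

theorem inner_sub_cosAngle_smul_self {x : E3} (hx : ‖x‖ = P.L) :
    inner ℝ (pd - cosAngle P pd x • x) x = (0 : ℝ) := by
  rw [inner_sub_left, real_inner_smul_left, real_inner_self_eq_norm_sq, hx, real_inner_comm,
    inner_eq_cosAngle P]
  ring

/-- Differentiating ‖p‖² = L² twice gives ⟨p, v⟩ = 0 and ⟨p, w⟩ = -‖v‖²; pairing the equation of
motion with p then determines the multiplier. The endpoints are discarded as a null set so that all
derivatives are two-sided. -/
theorem IsOuterSolution.ae_hasAcceleration (h : IsOuterSolution P pd T Rd ζ a p v τ)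
    (hpd : ‖pd‖ = P.L) :
    ∀ᵐ t, t ∈ Icc 0 τ →
      ∃ w, HasAcceleration P pd (disturbance (T t) (Rd t) (ζ t) (a t)) p v w t := by
  have hL := P.L_pos
  filter_upwards [h.dynamics, Measure.ae_ne volume (0 : ℝ), Measure.ae_ne volume τ]
    with t ht h0 h1 htI
  obtain ⟨w, hw, lam, hlam⟩ := ht htI
  have hIoo : t ∈ Ioo 0 τ := ⟨lt_of_le_of_ne htI.1 (Ne.symm h0), lt_of_le_of_ne htI.2 h1⟩
  have hp : ∀ s ∈ Ioo 0 τ, HasDerivAt p (v s) s := fun s hs =>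
    (h.deriv_p s (Ioo_subset_Icc_self hs)).hasDerivAt (Icc_mem_nhds hs.1 hs.2)
  have htan : ∀ s ∈ Ioo 0 τ, inner ℝ (p s) (v s) = (0 : ℝ) := by
    intro s hs
    have h1 := (hp s hs).norm_sq
    have h2 : (fun x => ‖p x‖ ^ 2) =ᶠ[𝓝 s] fun _ => P.L ^ 2 := by
      filter_upwards [Icc_mem_nhds hs.1 hs.2] with x hx
      rw [h.on_sphere x hx]
    have := (h1.congr_of_eventuallyEq h2.symm).unique (hasDerivAt_const s (P.L ^ 2))
    linarith
  have htan' : inner ℝ (p t) w + ‖v t‖ ^ 2 = 0 := by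
    have h1 := (hp t hIoo).inner ℝ hw
    have h2 : (fun x => inner ℝ (p x) (v x)) =ᶠ[𝓝 t] fun _ => (0 : ℝ) := by
      filter_upwards [Ioo_mem_nhds hIoo.1 hIoo.2] with x hx
      exact htan x hx
    have := (h1.congr_of_eventuallyEq h2.symm).unique (hasDerivAt_const t (0 : ℝ))
    rw [real_inner_self_eq_norm_sq] at this
    exact this
  have hpt := h.on_sphere t htI
  refine ⟨w, hp t hIoo, hw, hpt, htan t hIoo, ?_⟩
  rw [pdForce_eq hpd hpt] at hlam
  have hin := congrArg (fun x => inner ℝ x (p t)) hlam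
  simp only [inner_add_left, inner_sub_left, real_inner_smul_left,
    inner_sub_cosAngle_smul_self hpt, real_inner_self_eq_norm_sq, hpt] at hin
  rw [real_inner_comm] at htan'
  have h4 : inner ℝ (v t) (p t) = (0 : ℝ) := by rw [real_inner_comm]; exact htan t hIoo
  have hlam' : lam = -((P.m * ‖v t‖ ^ 2
      + inner ℝ (disturbance (T t) (Rd t) (ζ t) (a t)) (p t)) / P.L ^ 2) := by
    rw [h4] at hin
    rw [eq_neg_iff_add_eq_zero, ← eq_neg_iff_add_eq_zero, ← neg_div, eq_div_iff (by positivity)]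
    linear_combination (-1 : ℝ) * hin + P.m * htan'
  rw [hlam, hlam', neg_smul, ← sub_eq_add_neg]

theorem IsOuterSolution.absolutelyContinuous_p (h : IsOuterSolution P pd T Rd ζ a p v τ)
    (hτ : 0 ≤ τ) : AbsolutelyContinuousOnInterval p 0 τ := by
  obtain ⟨C, hC⟩ := h.abs_cont_v.exists_bound
  rw [uIcc_of_le hτ] at hC
  exact .of_hasDerivWithinAt hτ h.deriv_p hC

end

section
variable {P : Params} {pd δ w : E3} {p v : ℝ → E3} {t : ℝ}

/-- A tangent vector sees only the tangential part pd - y x of `pd`, whose length is L √(1 - y²). -/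
theorem inner_sq_le {x u : E3} (hpd : ‖pd‖ = P.L) (hx : ‖x‖ = P.L)
    (hu : inner ℝ x u = (0 : ℝ)) :
    (inner ℝ u pd : ℝ) ^ 2 ≤ P.L ^ 2 * (1 - cosAngle P pd x ^ 2) * ‖u‖ ^ 2 := by
  have h1 : inner ℝ u pd = (inner ℝ u (pd - cosAngle P pd x • x) : ℝ) := by
    rw [inner_sub_right, real_inner_smul_right, real_inner_comm x u, hu, mul_zero, sub_zero]
  have h2 : 0 ≤ 1 - cosAngle P pd x ^ 2 := by
    have := (sq_le_one_iff_abs_le_one _).2 (abs_cosAngle_le hpd hx); linarith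
  have h3 := abs_real_inner_le_norm u (pd - cosAngle P pd x • x)
  rw [norm_sub_cosAngle_smul hpd hx, ← h1] at h3
  have h4 := pow_le_pow_left₀ (abs_nonneg _) h3 2
  rw [sq_abs] at h4
  calc _ ≤ _ := h4
    _ = _ := by rw [mul_pow, mul_pow, Real.sq_sqrt h2]; ring

theorem HasAcceleration.hasDerivAt_cosAngle (h : HasAcceleration P pd δ p v w t) :
    HasDerivAt (fun s => cosAngle P pd (p s)) (inner ℝ (v t) pd / P.L ^ 2) t := by
  have := (h.deriv_p.inner ℝ (hasDerivAt_const t pd)).div_const (P.L ^ 2)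
  simpa [cosAngle] using this

theorem HasAcceleration.mass_mul_inner_desired (h : HasAcceleration P pd δ p v w t)
    (hpd : ‖pd‖ = P.L) :
    P.m * inner ℝ w pd =
      P.L ^ 4 * pdGain P (cosAngle P pd (p t)) * (1 - cosAngle P pd (p t) ^ 2)
        - P.Kd * inner ℝ (v t) pd + inner ℝ δ (pd - cosAngle P pd (p t) • p t)
        - P.m * ‖v t‖ ^ 2 * cosAngle P pd (p t) := by
  have hL := P.L_pos.ne'
  have hin := congrArg (fun x => inner ℝ x pd) h.dynamics
  simp only [inner_add_left, inner_sub_left, real_inner_smul_left, real_inner_self_eq_norm_sq,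
    hpd] at hin
  rw [inner_eq_cosAngle P pd (p t)] at hin
  rw [inner_sub_right, real_inner_smul_right, hin]
  field_simp
  ring

theorem HasAcceleration.mass_mul_inner_velocity (h : HasAcceleration P pd δ p v w t) :
    P.m * inner ℝ (v t) w =
      P.L ^ 2 * pdGain P (cosAngle P pd (p t)) * inner ℝ (v t) pd - P.Kd * ‖v t‖ ^ 2
        + inner ℝ (v t) δ := by
  have hin := congrArg (fun x => inner ℝ (v t) x) h.dynamics
  have ht : inner ℝ (v t) (p t) = (0 : ℝ) := by rw [real_inner_comm]; exact h.tangent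
  simp only [inner_add_right, inner_sub_right, real_inner_smul_right, real_inner_self_eq_norm_sq,
    ht] at hin
  rw [hin]; ring

end

/-! ### The strict Lyapunov function and its dissipation -/

/-- Strict Lyapunov function of the outer loop: the energy plus a weighted cross term. -/
def lyapunov (P : Params) (pd : E3) (ε : ℝ) (x u : E3) : ℝ :=
  P.m / 2 * ‖u‖ ^ 2 + cosPotential P (cosAngle P pd x)
    - ε * P.m * ((1 - cosAngle P pd x) * inner ℝ u pd)

section
variable {P : Params} {pd δ w x u : E3} {p v : ℝ → E3} {t ε : ℝ}

theorem one_sub_cosAngle_mem (hpd : ‖pd‖ = P.L) (hx : ‖x‖ = P.L) :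
    1 - cosAngle P pd x ∈ Icc (0 : ℝ) 2 := by
  have := abs_le.1 (abs_cosAngle_le hpd hx)
  constructor <;> linarith

theorem abs_inner_sub_le (hpd : ‖pd‖ = P.L) (hx : ‖x‖ = P.L) :
    |inner ℝ δ (pd - cosAngle P pd x • x)| ≤ P.L * √(1 - cosAngle P pd x ^ 2) * ‖δ‖ := by
  have := abs_real_inner_le_norm δ (pd - cosAngle P pd x • x)
  rw [norm_sub_cosAngle_smul hpd hx] at this
  linarith

/-- Here n is the speed, s = ⟨v, pd⟩, D = ‖δ‖, i₁ = ⟨v, δ⟩ and i₂ = ⟨δ, pd - y p⟩. Young's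
inequality spends Kd/4 of the damping on i₁. The cross term creates ε (3 m + Kd² / (2 b L²)) n² of
unwanted kinetic terms, which `hε1` pays with another Kd/4; half of the restoring term pays for the
mixed product N Kd s. -/
theorem dissipation_inequality {m Kd L b ε n s N φ D i₁ i₂ : ℝ} (hm : 0 < m) (hKd : 0 < Kd)
    (hL : 0 < L) (hb : 0 < b) (hε : 0 < ε)
    (hε1 : ε * (3 * m + Kd ^ 2 / (2 * b * L ^ 2)) ≤ Kd / 4) (hN : 0 ≤ N) (hN2 : N ≤ 2)
    (hs : s ^ 2 ≤ L ^ 2 * (N * (2 - N)) * n ^ 2) (hφ : b * N ≤ φ)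
    (hi₁ : i₁ ≤ n * D) (hi₂ : |i₂| ≤ L * D) :
    -(Kd * n ^ 2) + i₁ + ε * m * (s ^ 2 / L ^ 2) - ε * N * (L ^ 4 * φ * (N * (2 - N)))
      + ε * N * (Kd * s) - ε * N * i₂ + ε * N * (m * n ^ 2 * (1 - N))
    ≤ -(Kd / 2 * n ^ 2) - ε * b * L ^ 4 / 2 * (N ^ 2 * (N * (2 - N)))
      + D ^ 2 / Kd + 2 * ε * L * D := by
  set q := N * (2 - N) with hq
  have hq0 : 0 ≤ q := mul_nonneg hN (by linarith)
  have hq1 : q ≤ 1 := by nlinarith [sq_nonneg (N - 1)]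
  have h1 : n * D ≤ Kd / 4 * n ^ 2 + D ^ 2 / Kd := by
    have h2 : Kd / 4 * n ^ 2 + D ^ 2 / Kd - n * D = (Kd * n / 2 - D) ^ 2 / Kd := by
      field_simp; ring
    have : 0 ≤ (Kd * n / 2 - D) ^ 2 / Kd := by positivity
    linarith
  have h2 : s ^ 2 / L ^ 2 ≤ n ^ 2 := by
    rw [div_le_iff₀ (by positivity)]
    nlinarith [mul_nonneg (sub_nonneg.2 hq1) (mul_nonneg (sq_nonneg L) (sq_nonneg n))]
  have h3 : N * (L ^ 4 * (b * N) * q) ≤ N * (L ^ 4 * φ * q) := by gcongr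
  have h4 : N * (Kd * s) ≤ b * L ^ 4 / 2 * (N ^ 2 * q) + Kd ^ 2 / (2 * b * L ^ 2) * n ^ 2 := by
    -- Young's inequality is used with weight q, which cancels the q in the bound for s²; at q = 0
    -- (`pd` or the antipode) that bound forces s = 0.
    rcases hq0.eq_or_lt with hq' | hq'
    · rw [← hq'] at hs
      have : s = 0 := by nlinarith [sq_nonneg s]
      rw [this, ← hq']
      simp only [mul_zero, zero_add]; positivity
    · have h5 : Kd ^ 2 / (2 * b * L ^ 4 * q) * s ^ 2 ≤ Kd ^ 2 / (2 * b * L ^ 2) * n ^ 2 := by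
        rw [div_mul_eq_mul_div, div_mul_eq_mul_div, div_le_div_iff₀ (by positivity) (by positivity)]
        have := mul_le_mul_of_nonneg_left hs (a := Kd ^ 2 * (2 * b * L ^ 2)) (by positivity)
        nlinarith
      have h6 : b * L ^ 4 / 2 * (N ^ 2 * q) + Kd ^ 2 / (2 * b * L ^ 4 * q) * s ^ 2 - N * (Kd * s)
          = (b * L ^ 4 * q * N - Kd * s) ^ 2 / (2 * b * L ^ 4 * q) := by
        field_simp; ring
      have : 0 ≤ (b * L ^ 4 * q * N - Kd * s) ^ 2 / (2 * b * L ^ 4 * q) := by positivity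
      linarith
  have h7 : -(N * i₂) ≤ 2 * (L * D) := by
    have h8 : N * -i₂ ≤ N * (L * D) :=
      mul_le_mul_of_nonneg_left ((neg_le_abs i₂).trans hi₂) hN
    have h9 : 0 ≤ L * D := (abs_nonneg i₂).trans hi₂
    nlinarith
  have h8 : N * (m * n ^ 2 * (1 - N)) ≤ 2 * (m * n ^ 2) := by
    have : 0 ≤ m * n ^ 2 := by positivity
    nlinarith [mul_nonneg this (sq_nonneg N), mul_nonneg this hN,
      mul_nonneg this (sub_nonneg.2 hN2)]
  have h9 := mul_le_mul_of_nonneg_left h2 (mul_pos hε hm).le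
  have h10 := mul_le_mul_of_nonneg_left h3 hε.le
  have h11 := mul_le_mul_of_nonneg_left h4 hε.le
  have h12 := mul_le_mul_of_nonneg_left h7 hε.le
  have h13 := mul_le_mul_of_nonneg_left h8 hε.le
  have h14 := mul_le_mul_of_nonneg_right hε1 (sq_nonneg n)
  linarith

theorem HasAcceleration.lyapunov_deriv_le (h : HasAcceleration P pd δ p v w t)
    (hpd : ‖pd‖ = P.L) (hε : 0 < ε)
    (hε1 : ε * (3 * P.m + P.Kd ^ 2 / (2 * gainSlope P * P.L ^ 2)) ≤ P.Kd / 4) :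
    ∃ V', HasDerivAt (fun s => lyapunov P pd ε (p s) (v s)) V' t ∧
      V' ≤ -(P.Kd / 2 * ‖v t‖ ^ 2) - ε * gainSlope P * P.L ^ 4 / 2 *
          ((1 - cosAngle P pd (p t)) ^ 2 * ((1 - cosAngle P pd (p t)) * (1 + cosAngle P pd (p t))))
        + ‖δ‖ ^ 2 / P.Kd + 2 * ε * P.L * ‖δ‖ := by
  have hL := P.L_pos
  have hy := h.hasDerivAt_cosAngle
  have h1 := h.deriv_v.norm_sq.const_mul (P.m / 2)
  have h2 := (hasDerivAt_cosPotential P (cosAngle P pd (p t))).comp t hy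
  have h3 := ((hy.const_sub 1).mul (h.deriv_v.inner ℝ (hasDerivAt_const t pd))).const_mul (ε * P.m)
  refine ⟨_, (h1.add h2).sub h3, ?_⟩
  have hN := one_sub_cosAngle_mem hpd h.norm_p
  have hs := inner_sq_le hpd h.norm_p h.tangent
  have hφ := gainSlope_mul_one_sub_le P (abs_cosAngle_le hpd h.norm_p)
  have hi₂ : |inner ℝ δ (pd - cosAngle P pd (p t) • p t)| ≤ P.L * ‖δ‖ := by
    refine (abs_inner_sub_le hpd h.norm_p).trans ?_
    have : √(1 - cosAngle P pd (p t) ^ 2) ≤ 1 := Real.sqrt_le_one.2 (by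
      linarith [sq_nonneg (cosAngle P pd (p t))])
    have : P.L * √(1 - cosAngle P pd (p t) ^ 2) ≤ P.L := by nlinarith
    exact mul_le_mul_of_nonneg_right this (norm_nonneg _)
  have hw := h.mass_mul_inner_desired hpd
  have hvw := h.mass_mul_inner_velocity
  have key := dissipation_inequality (φ := pdGain P (cosAngle P pd (p t)))
    (s := inner ℝ (v t) pd) (n := ‖v t‖)
    P.m_pos P.Kd_pos hL (gainSlope_pos P) hε hε1 hN.1 hN.2 (by
      convert hs using 3; ring) hφ (real_inner_le_norm (v t) δ) hi₂
  generalize cosAngle P pd (p t) = y at *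
  generalize pdGain P y = φ at *
  simp only [inner_zero_right, zero_add]
  have e1 : (1 - y) * (2 - (1 - y)) = (1 - y) * (1 + y) := by ring
  rw [e1] at key
  refine le_trans (le_of_eq ?_) key
  have e2 : P.L ^ 4 * φ * (inner ℝ (v t) pd / P.L ^ 2) = P.L ^ 2 * φ * inner ℝ (v t) pd := by
    field_simp
  linear_combination hvw - ε * (1 - y) * hw - e2

theorem abs_inner_desired_le (hpd : ‖pd‖ = P.L) (u : E3) : |inner ℝ u pd| ≤ P.L * ‖u‖ := by
  have := abs_real_inner_le_norm u pd
  rw [hpd] at this; linarith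

theorem cross_term_le (hpd : ‖pd‖ = P.L) (hx : ‖x‖ = P.L) (hε : 0 < ε) (u : E3) :
    |ε * P.m * ((1 - cosAngle P pd x) * inner ℝ u pd)|
      ≤ ε * P.m * P.L * ((1 - cosAngle P pd x) * ‖u‖) := by
  have hN := one_sub_cosAngle_mem hpd hx
  have hm := P.m_pos
  rw [abs_mul (ε * P.m), abs_mul (1 - _), abs_of_pos (mul_pos hε hm), abs_of_nonneg hN.1]
  have := mul_le_mul_of_nonneg_left (abs_inner_desired_le hpd u)
    (mul_nonneg (mul_pos hε hm).le hN.1)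
  linarith

/-- Completing the square, the cross term costs m/4 ‖u‖² and ε² m L² N², at most half of the kinetic
and of the potential lower bound. -/
theorem le_lyapunov (hpd : ‖pd‖ = P.L) (hx : ‖x‖ = P.L) (hε : 0 < ε)
    (hε2 : ε ^ 2 * P.m ≤ gainSlope P * P.L ^ 2 / 4) (u : E3) :
    P.m / 4 * ‖u‖ ^ 2 + gainSlope P * P.L ^ 4 / 4 * (1 - cosAngle P pd x) ^ 2
      ≤ lyapunov P pd ε x u := by
  have h1 := (le_abs_self _).trans (cross_term_le hpd hx hε u)
  have h2 := le_cosPotential P (abs_cosAngle_le hpd hx)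
  have hm := P.m_pos
  rw [lyapunov]
  generalize 1 - cosAngle P pd x = N at *
  have h3 : ε * P.m * P.L * (N * ‖u‖) ≤ P.m / 4 * ‖u‖ ^ 2 + ε ^ 2 * P.m * (P.L ^ 2 * N ^ 2) := by
    have := mul_nonneg hm.le (sq_nonneg (‖u‖ / 2 - ε * P.L * N))
    nlinarith
  have h4 := mul_le_mul_of_nonneg_right hε2 (a := P.L ^ 2 * N ^ 2) (by positivity)
  linarith

theorem lyapunov_le (hpd : ‖pd‖ = P.L) (hx : ‖x‖ = P.L) (hε : 0 < ε)
    (hε2 : ε ^ 2 * P.m ≤ gainSlope P * P.L ^ 2 / 4) (u : E3) :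
    lyapunov P pd ε x u ≤ (P.m + P.L ^ 4 * (P.Kp * P.L / P.μ * Real.pi)
      + gainSlope P * P.L ^ 4) * (‖u‖ ^ 2 + (1 - cosAngle P pd x)) := by
  have h1 := (neg_le_abs _).trans (cross_term_le hpd hx hε u)
  have h2 := cosPotential_le P (abs_cosAngle_le hpd hx)
  have hN := one_sub_cosAngle_mem hpd hx
  have hm := P.m_pos
  have hL := P.L_pos
  have hb := gainSlope_pos P
  have hB : 0 < P.L ^ 4 * (P.Kp * P.L / P.μ * Real.pi) := by
    have := P.Kp_pos; have := P.μ_pos; positivity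
  rw [lyapunov]
  generalize 1 - cosAngle P pd x = N at *
  generalize P.L ^ 4 * (P.Kp * P.L / P.μ * Real.pi) = B at *
  have h3 : ε * P.m * P.L * (N * ‖u‖) ≤ P.m / 4 * ‖u‖ ^ 2 + ε ^ 2 * P.m * (P.L ^ 2 * N ^ 2) := by
    have := mul_nonneg hm.le (sq_nonneg (‖u‖ / 2 - ε * P.L * N))
    nlinarith
  have h4 := mul_le_mul_of_nonneg_right hε2 (a := P.L ^ 2 * N ^ 2) (by positivity)
  have h5 : gainSlope P * P.L ^ 4 / 4 * N ^ 2 ≤ gainSlope P * P.L ^ 4 / 2 * N := by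
    have : 0 ≤ gainSlope P * P.L ^ 4 := by positivity
    nlinarith [hN.1, hN.2, mul_nonneg this (mul_nonneg hN.1 (sub_nonneg.2 hN.2))]
  have h6 : 0 ≤ P.m * ‖u‖ ^ 2 := by positivity
  have h7 : 0 ≤ B * ‖u‖ ^ 2 := by positivity
  have h8 : 0 ≤ gainSlope P * P.L ^ 4 * ‖u‖ ^ 2 := by positivity
  have h9 := mul_nonneg hm.le hN.1
  have h10 : 0 ≤ gainSlope P * P.L ^ 4 * N := mul_nonneg (by positivity) hN.1
  linarith

theorem lipschitzWith_cosAngle (P : Params) (pd : E3) :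
    LipschitzWith (‖pd‖ / P.L ^ 2).toNNReal (cosAngle P pd) := by
  refine LipschitzWith.of_dist_le_mul fun x y => ?_
  have hL := P.L_pos
  rw [Real.coe_toNNReal _ (by positivity), Real.dist_eq, cosAngle, cosAngle, ← sub_div,
    ← inner_sub_left, abs_div, abs_of_pos (pow_pos hL 2), dist_eq_norm, div_mul_eq_mul_div]
  gcongr
  exact (abs_real_inner_le_norm _ _).trans (le_of_eq (mul_comm _ _))

theorem lipschitzWith_inner_right (y : E3) :
    LipschitzWith ‖y‖₊ (fun x : E3 => (inner ℝ x y : ℝ)) := by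
  refine LipschitzWith.of_dist_le_mul fun x z => ?_
  rw [Real.dist_eq, ← inner_sub_left, dist_eq_norm, coe_nnnorm, mul_comm]
  exact abs_real_inner_le_norm _ _

theorem absolutelyContinuous_const (c a b : ℝ) :
    AbsolutelyContinuousOnInterval (fun _ : ℝ => c) a b :=
  (LipschitzWith.const c).lipschitzOnWith.absolutelyContinuousOnInterval

theorem absolutelyContinuous_lyapunov {a b : ℝ} (hp : AbsolutelyContinuousOnInterval p a b)
    (hv : AbsolutelyContinuousOnInterval v a b) :
    AbsolutelyContinuousOnInterval (fun s => lyapunov P pd ε (p s) (v s)) a b := by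
  have h1 := hv.comp_lipschitz lipschitzWith_one_norm
  have hy := hp.comp_lipschitz (lipschitzWith_cosAngle P pd)
  have h2 := hy.comp_lipschitz (lipschitzWith_cosPotential P)
  have h3 := hv.comp_lipschitz (lipschitzWith_inner_right pd)
  have h4 := (absolutelyContinuous_const 1 a b).fun_sub hy
  have h5 := (((h1.fun_mul h1).const_mul (P.m / 2)).fun_add h2).fun_sub
    ((h4.fun_mul h3).const_mul (ε * P.m))
  convert! h5 using 2 with s
  simp only [lyapunov, sq]

end

/-! ### Certificate on a sublevel set below the barrier -/

/-- A function of the state that certifies the stability of the outer loop on the sublevel set of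
level `c₁`; the initial states of interest lie in that of level `c₀`. -/
structure LyapunovCertificate (P : Params) (pd : E3) (c Tsup : ℝ) where
  V : E3 → E3 → ℝ
  A : ℝ
  l : ℝ
  k : ℝ
  C : ℝ
  c₀ : ℝ
  c₁ : ℝ
  A_pos : 0 < A
  l_pos : 0 < l
  k_pos : 0 < k
  C_pos : 0 < C
  c₀_pos : 0 < c₀
  c₀_lt : c₀ < c₁
  absolutelyContinuous : ∀ {p v : ℝ → E3} {a b : ℝ}, AbsolutelyContinuousOnInterval p a b →
    AbsolutelyContinuousOnInterval v a b →
    AbsolutelyContinuousOnInterval (fun s => V (p s) (v s)) a b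
  lower : ∀ x u : E3, ‖x‖ = P.L → l * (‖u‖ ^ 2 + (1 - cosAngle P pd x) ^ 2) ≤ V x u
  upper : ∀ x u : E3, ‖x‖ = P.L → V x u ≤ A * (‖u‖ ^ 2 + (1 - cosAngle P pd x))
  initial : ∀ x u : E3, ‖x‖ = P.L → energy P pd x u ≤ c → V x u ≤ c₀
  decay : ∀ {p v : ℝ → E3} {δ w : E3} {t z : ℝ}, HasAcceleration P pd δ p v w t →
    ‖δ‖ ≤ Tsup * z → z ≤ 1 → V (p t) (v t) < c₁ →
    ∃ V', HasDerivAt (fun s => V (p s) (v s)) V' t ∧ V' ≤ -(k * V (p t) (v t) ^ 3) + C * z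

/-- The barrier is the value of the continuous potential at y = -1, so a lower level excludes a
neighbourhood of the antipode. -/
theorem exists_barrier_margin (P : Params) {c : ℝ} (hc : c < barrier P) :
    ∃ η, 0 < η ∧ ∀ y, |y| ≤ 1 → cosPotential P y ≤ c → η ≤ 1 + y := by
  rw [barrier_eq] at hc
  have h := (continuous_cosPotential P).continuousAt.eventually (lt_mem_nhds hc)
  obtain ⟨η, hη, hball⟩ := Metric.eventually_nhds_iff.1 h
  refine ⟨η, hη, fun y hy hyc => ?_⟩
  by_contra! hlt
  have := hball (y := y) (by
    rw [Real.dist_eq, sub_neg_eq_add, abs_lt]; constructor <;> linarith [(abs_le.1 hy).1])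
  linarith

theorem eventually_nhdsGT_zero_lt {f : ℝ → ℝ} {x : ℝ} (hf : Continuous f) (h0 : f 0 = 0)
    (hx : 0 < x) : ∀ᶠ ε in 𝓝[>] (0 : ℝ), f ε < x :=
  (hf.continuousAt.eventually (gt_mem_nhds (h0.trans_lt hx))).filter_mono nhdsWithin_le_nhds

theorem exists_small_parameter {x₁ a₁ x₂ a₂ x₃ a₃ x₄ a₄ : ℝ} (h₁ : 0 < x₁) (h₂ : 0 < x₂)
    (h₃ : 0 < x₃) (h₄ : 0 < x₄) :
    ∃ ε : ℝ, 0 < ε ∧ ε * a₁ < x₁ ∧ ε ^ 2 * a₂ < x₂ ∧ ε ^ 2 * a₃ < x₃ ∧ ε * a₄ < x₄ := by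
  have hpos : ∀ᶠ ε in 𝓝[>] (0 : ℝ), 0 < ε := self_mem_nhdsWithin
  exact (hpos.and <|
    (eventually_nhdsGT_zero_lt (f := fun ε => ε * a₁) (by fun_prop) (by simp) h₁).and <|
    (eventually_nhdsGT_zero_lt (f := fun ε => ε ^ 2 * a₂) (by fun_prop) (by simp) h₂).and <|
    (eventually_nhdsGT_zero_lt (f := fun ε => ε ^ 2 * a₃) (by fun_prop) (by simp) h₃).and
    (eventually_nhdsGT_zero_lt (f := fun ε => ε * a₄) (by fun_prop) (by simp) h₄)).exists

/-- For n₂ the squared speed, (n₂ + N)³ ≤ 4 (n₂³ + N³) and n₂³ ≤ B² n₂ on a bounded set. The cube is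
dictated by the weak restoring term N³. -/
theorem cube_le_dissipation {A B n₂ N V a b : ℝ} (hA : 0 < A) (ha : 0 < a)
    (hb : 0 < b) (hn : 0 ≤ n₂) (hnB : n₂ ≤ B) (hN : 0 ≤ N) (hV0 : 0 ≤ V)
    (hV : V ≤ A * (n₂ + N)) :
    (4 * A ^ 3 * (B ^ 2 / a + 1 / b))⁻¹ * V ^ 3 ≤ a * n₂ + b * N ^ 3 := by
  have hK : 0 < 4 * A ^ 3 * (B ^ 2 / a + 1 / b) := by positivity
  rw [inv_mul_le_iff₀ hK]
  have h1 : V ^ 3 ≤ (A * (n₂ + N)) ^ 3 := pow_le_pow_left₀ hV0 hV 3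
  have h2 : (n₂ + N) ^ 3 ≤ 4 * (n₂ ^ 3 + N ^ 3) := by
    nlinarith [mul_nonneg (add_nonneg hn hN) (sq_nonneg (n₂ - N))]
  have h3 : n₂ ^ 3 ≤ B ^ 2 * n₂ := by
    have : n₂ ^ 2 ≤ B ^ 2 := pow_le_pow_left₀ hn hnB 2
    nlinarith
  have h4 : n₂ ^ 3 + N ^ 3 ≤ (B ^ 2 / a + 1 / b) * (a * n₂ + b * N ^ 3) := by
    have e : (B ^ 2 / a + 1 / b) * (a * n₂ + b * N ^ 3)
        = B ^ 2 * n₂ + N ^ 3 + (B ^ 2 / a * (b * N ^ 3) + 1 / b * (a * n₂)) := by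
      field_simp; ring
    have : 0 ≤ B ^ 2 / a * (b * N ^ 3) + 1 / b * (a * n₂) := by positivity
    linarith
  calc V ^ 3 ≤ A ^ 3 * (n₂ + N) ^ 3 := by rw [← mul_pow]; exact h1
    _ ≤ A ^ 3 * (4 * ((B ^ 2 / a + 1 / b) * (a * n₂ + b * N ^ 3))) := by
        gcongr; linarith
    _ = _ := by ring

set_option maxHeartbeats 800000 in
theorem exists_lyapunovCertificate {P : Params} {pd : E3} (hpd : ‖pd‖ = P.L) {c : ℝ}
    (hc : c < barrier P) {Tsup : ℝ} (hT : 0 < Tsup) :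
    Nonempty (LyapunovCertificate P pd c Tsup) := by
  have hm := P.m_pos
  have hL := P.L_pos
  have hKd := P.Kd_pos
  have hb := gainSlope_pos P
  have hbar : 0 < barrier P := by
    rw [barrier_eq]
    have := le_cosPotential P (y := -1) (by simp)
    have h2 : 0 < P.L ^ 4 * gainSlope P / 2 * (1 - -1) ^ 2 := by positivity
    linarith
  -- A negative c is allowed, but the certificate needs positive levels.
  set cp := max c 0 with hcp
  have hcp0 : 0 ≤ cp := le_max_right _ _
  have hcpb : cp < barrier P := max_lt hc hbar
  -- The gap is cut in four: V starts below cp + κ, the decay holds below cp + 2κ, the potential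
  -- there stays below cp + 3κ, and the barrier is cp + 4κ.
  set κ := (barrier P - cp) / 4 with hκ
  have hκ0 : 0 < κ := by rw [hκ]; linarith
  obtain ⟨η, hη, hmargin⟩ := exists_barrier_margin P (c := cp + 3 * κ) (by rw [hκ]; linarith)
  -- In order: the dissipation inequality; coercivity of V; V < c₁ gives potential below cp + 3κ, as
  -- 2 ε m L n - m n²/2 ≤ 2 ε² m L²; initial states gain at most κ from the cross term, as N n ≤ 2 n
  -- ≤ 1 + n².
  obtain ⟨ε, hε, hε1, hε2, hε3, hε4⟩ := exists_small_parameter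
    (a₁ := 3 * P.m + P.Kd ^ 2 / (2 * gainSlope P * P.L ^ 2)) (x₁ := P.Kd / 4)
    (a₂ := P.m) (x₂ := gainSlope P * P.L ^ 2 / 4)
    (a₃ := 2 * P.m * P.L ^ 2) (x₃ := κ)
    (a₄ := P.m * P.L * (1 + 2 * cp / P.m)) (x₄ := κ) (by positivity) (by positivity) hκ0 hκ0
  replace hε1 := hε1.le
  replace hε2 := hε2.le
  set A := P.m + P.L ^ 4 * (P.Kp * P.L / P.μ * Real.pi) + gainSlope P * P.L ^ 4 with hA
  have hA0 : 0 < A := by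
    have := P.Kp_pos; have := P.μ_pos; have := Real.pi_pos; positivity
  set l := min (P.m / 4) (gainSlope P * P.L ^ 4 / 4) with hl
  have hl0 : 0 < l := lt_min (by positivity) (by positivity)
  have hlow : ∀ x u : E3, ‖x‖ = P.L →
      l * (‖u‖ ^ 2 + (1 - cosAngle P pd x) ^ 2) ≤ lyapunov P pd ε x u := by
    intro x u hx
    refine le_trans ?_ (le_lyapunov hpd hx hε hε2 u)
    rw [mul_add]
    exact add_le_add (mul_le_mul_of_nonneg_right (min_le_left _ _) (sq_nonneg _))
      (mul_le_mul_of_nonneg_right (min_le_right _ _) (sq_nonneg _))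
  set a := P.Kd / 2 with ha
  set b := ε * gainSlope P * P.L ^ 4 / 2 * η with hbdef
  refine ⟨⟨lyapunov P pd ε, A, l, (4 * A ^ 3 * (((cp + 2 * κ) / l) ^ 2 / a + 1 / b))⁻¹,
    Tsup ^ 2 / P.Kd + 2 * ε * P.L * Tsup, cp + κ, cp + 2 * κ, hA0, hl0, by positivity,
    by positivity, by positivity, by linarith, absolutelyContinuous_lyapunov, hlow,
    fun x u hx => lyapunov_le hpd hx hε hε2 u, ?_, ?_⟩⟩
  · intro x u hx hE
    rw [energy, potential_gcDist P pd x hpd hx] at hE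
    have h1 := (neg_le_abs _).trans (cross_term_le hpd hx hε u)
    have h2 := le_cosPotential P (abs_cosAngle_le hpd hx)
    have hN := one_sub_cosAngle_mem hpd hx
    have h3 : 0 ≤ cosPotential P (cosAngle P pd x) := le_trans (by positivity) h2
    have h4 : ‖u‖ ^ 2 ≤ 2 * cp / P.m := by
      rw [le_div_iff₀ hm]; linarith [le_max_left c 0]
    have h5 : (1 - cosAngle P pd x) * ‖u‖ ≤ 1 + 2 * cp / P.m := by
      have := mul_le_mul_of_nonneg_right hN.2 (norm_nonneg u)
      linarith [sq_nonneg (‖u‖ - 1)]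
    have h6 := mul_le_mul_of_nonneg_left h5 (mul_pos (mul_pos hε hm) hL).le
    rw [lyapunov]
    linarith [le_max_left c 0]
  · intro p v δ w t z h hδ hz hV
    obtain ⟨V', hV', hle⟩ := h.lyapunov_deriv_le hpd hε hε1
    refine ⟨V', hV', hle.trans ?_⟩
    have hp := h.norm_p
    have hN := one_sub_cosAngle_mem hpd hp
    have hlo := hlow (p t) (v t) hp
    have hup := lyapunov_le hpd hp hε hε2 (v t)
    have hy := abs_cosAngle_le hpd hp
    have hz0 : 0 ≤ z := by
      have := (norm_nonneg δ).trans hδ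
      exact nonneg_of_mul_nonneg_right this hT
    have hn : ‖v t‖ ^ 2 ≤ (cp + 2 * κ) / l := by
      rw [le_div_iff₀ hl0]
      linarith [mul_nonneg hl0.le (sq_nonneg (1 - cosAngle P pd (p t)))]
    have hV0 : 0 ≤ lyapunov P pd ε (p t) (v t) := le_trans (by positivity) hlo
    have hη' : η ≤ 1 + cosAngle P pd (p t) := by
      refine hmargin _ hy ?_
      have h1 := (le_abs_self _).trans (cross_term_le hpd hp hε (v t))
      rw [lyapunov] at hV
      have h2 := mul_le_mul_of_nonneg_left
        (mul_le_mul_of_nonneg_right hN.2 (norm_nonneg (v t))) (mul_pos (mul_pos hε hm) hL).le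
      have h3 := mul_nonneg hm.le (sq_nonneg (‖v t‖ - 2 * ε * P.L))
      linarith
    have key := cube_le_dissipation (a := a) (b := b) (N := 1 - cosAngle P pd (p t)) hA0
      (by positivity) (by positivity) (sq_nonneg ‖v t‖) hn hN.1 hV0 hup
    have h7 : b * (1 - cosAngle P pd (p t)) ^ 3 ≤ ε * gainSlope P * P.L ^ 4 / 2 *
        ((1 - cosAngle P pd (p t)) ^ 2 *
          ((1 - cosAngle P pd (p t)) * (1 + cosAngle P pd (p t)))) := by
      have h8 := mul_le_mul_of_nonneg_left hη' (a := ε * gainSlope P * P.L ^ 4 / 2 *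
        (1 - cosAngle P pd (p t)) ^ 3) (mul_nonneg (by positivity) (pow_nonneg hN.1 3))
      rw [hbdef]; linarith
    -- Since z ≤ 1, the quadratic disturbance term is also linear in z.
    have h9 : ‖δ‖ ^ 2 / P.Kd ≤ Tsup ^ 2 / P.Kd * z := by
      rw [div_mul_eq_mul_div]
      gcongr
      calc ‖δ‖ ^ 2 ≤ (Tsup * z) ^ 2 := pow_le_pow_left₀ (norm_nonneg _) hδ 2
        _ = Tsup ^ 2 * (z * z) := by ring
        _ ≤ Tsup ^ 2 * z := by gcongr; exact mul_le_of_le_one_left hz0 hz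
    have h10 := mul_le_mul_of_nonneg_left hδ (by positivity : 0 ≤ 2 * ε * P.L)
    refine le_trans ?_ (add_le_add_left (neg_le_neg (key.trans (add_le_add_right h7 _))) _)
    rw [ha]
    linarith

/-! ### Cubic decay and the comparison functions -/

/-- The solution of `u' = -k u ^ 3` with initial value `x`. -/
def cubicDecay (k x t : ℝ) : ℝ := x / √(1 + 2 * k * x ^ 2 * t)

section cubicDecay

variable {k : ℝ}

theorem cubicDecay_zero (k x : ℝ) : cubicDecay k x 0 = x := by simp [cubicDecay]

theorem one_le_cubicDecay_arg (hk : 0 < k) (x : ℝ) {t : ℝ} (ht : 0 ≤ t) :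
    1 ≤ 1 + 2 * k * x ^ 2 * t := by
  have : 0 ≤ 2 * k * x ^ 2 * t := by positivity
  linarith

theorem cubicDecay_nonneg (k : ℝ) {x : ℝ} (hx : 0 ≤ x) (t : ℝ) : 0 ≤ cubicDecay k x t :=
  div_nonneg hx (Real.sqrt_nonneg _)

theorem hasDerivAt_cubicDecay (hk : 0 < k) (x : ℝ) {t : ℝ} (ht : 0 ≤ t) :
    HasDerivAt (cubicDecay k x) (-(k * cubicDecay k x t ^ 3)) t := by
  have h1 := one_le_cubicDecay_arg hk x ht
  have hpos : 0 < 1 + 2 * k * x ^ 2 * t := by linarith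
  have hlin : HasDerivAt (fun t : ℝ => 1 + 2 * k * x ^ 2 * t) (2 * k * x ^ 2) t := by
    simpa using ((hasDerivAt_id t).const_mul (2 * k * x ^ 2)).const_add 1
  have h2 := (hasDerivAt_const t x).div (hlin.sqrt hpos.ne') (Real.sqrt_ne_zero'.2 hpos)
  convert! h2 using 1
  have h3 : √(1 + 2 * k * x ^ 2 * t) ≠ 0 := Real.sqrt_ne_zero'.2 hpos
  rw [cubicDecay]
  field_simp
  ring

theorem cubicDecay_lt (hk : 0 < k) {x y t : ℝ} (hx : 0 ≤ x) (hxy : x < y) (ht : 0 ≤ t) :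
    cubicDecay k x t < cubicDecay k y t := by
  have h1 := one_le_cubicDecay_arg hk x ht
  have h2 := one_le_cubicDecay_arg hk y ht
  rw [cubicDecay, cubicDecay, div_lt_div_iff₀ (Real.sqrt_pos.2 (by linarith))
    (Real.sqrt_pos.2 (by linarith))]
  refine lt_of_pow_lt_pow_left₀ 2 (mul_nonneg (hx.trans hxy.le) (Real.sqrt_nonneg _)) ?_
  rw [mul_pow, mul_pow, Real.sq_sqrt (by linarith), Real.sq_sqrt (by linarith)]
  have : x ^ 2 < y ^ 2 := pow_lt_pow_left₀ hxy hx two_ne_zero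
  linarith

theorem cubicDecay_mono (hk : 0 < k) {x y t : ℝ} (hx : 0 ≤ x) (hxy : x ≤ y) (ht : 0 ≤ t) :
    cubicDecay k x t ≤ cubicDecay k y t := by
  rcases hxy.eq_or_lt with rfl | h
  · exact le_rfl
  · exact (cubicDecay_lt hk hx h ht).le

theorem antitoneOn_cubicDecay (hk : 0 < k) {x : ℝ} (hx : 0 ≤ x) :
    AntitoneOn (cubicDecay k x) (Ici 0) := by
  intro s hs t _ hst
  have h1 := one_le_cubicDecay_arg hk x hs
  refine div_le_div_of_nonneg_left hx (Real.sqrt_pos.2 (by linarith)) (Real.sqrt_le_sqrt ?_)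
  have : 2 * k * x ^ 2 * s ≤ 2 * k * x ^ 2 * t := by gcongr
  linarith

theorem tendsto_cubicDecay (hk : 0 < k) {x : ℝ} (hx : 0 ≤ x) :
    Tendsto (cubicDecay k x) atTop (𝓝 0) := by
  rcases hx.eq_or_lt with rfl | h
  · have h : cubicDecay k 0 = fun _ => 0 := by ext; simp [cubicDecay]
    rw [h]; exact tendsto_const_nhds
  · refine Tendsto.div_atTop tendsto_const_nhds (Real.tendsto_sqrt_atTop.comp ?_)
    exact tendsto_atTop_add_const_left _ _ (tendsto_id.const_mul_atTop (by positivity))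

theorem continuousOn_cubicDecay (hk : 0 < k) :
    ContinuousOn (fun z : ℝ × ℝ => cubicDecay k z.1 z.2) (univ ×ˢ Ici 0) := by
  refine ContinuousOn.div (by fun_prop) (by fun_prop) fun z hz => ?_
  have h1 := one_le_cubicDecay_arg hk z.1 hz.2
  exact Real.sqrt_ne_zero'.2 (by linarith)

end cubicDecay

/-- V(0) is bounded by A e(0)², and e(t)⁴ by K V(t), hence the square inside and the fourth root
outside. -/
theorem isClassKL_sqrt_sqrt_cubicDecay {k K A : ℝ} (hk : 0 < k) (hK : 0 < K) (hA : 0 < A) :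
    IsClassKL fun s t => √√(K * cubicDecay k (A * s ^ 2) t) := by
  refine ⟨?_, fun t ht => ⟨?_, ?_, ?_⟩, fun r hr => ?_, fun r hr => ?_⟩
  · have h : ContinuousOn (fun z : ℝ × ℝ => cubicDecay k (A * z.1 ^ 2) z.2) (Ici 0 ×ˢ Ici 0) :=
      (continuousOn_cubicDecay hk).comp
        (f := fun z : ℝ × ℝ => (A * z.1 ^ 2, z.2)) (by fun_prop) fun z hz => ⟨mem_univ _, hz.2⟩
    exact (Real.continuous_sqrt.comp Real.continuous_sqrt).comp_continuousOn
      (continuousOn_const.mul h)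
  · have h : ContinuousOn (fun s : ℝ => cubicDecay k (A * s ^ 2) t) (Ici 0) :=
      (continuousOn_cubicDecay hk).comp
        (f := fun s : ℝ => (A * s ^ 2, t)) (by fun_prop) fun z hz => ⟨mem_univ _, ht⟩
    exact (Real.continuous_sqrt.comp Real.continuous_sqrt).comp_continuousOn
      (continuousOn_const.mul h)
  · intro x hx y _ hxy
    have hx0 : (0 : ℝ) ≤ x := hx
    have h1 : A * x ^ 2 < A * y ^ 2 := by gcongr
    have h2 := cubicDecay_lt hk (by positivity) h1 ht
    have h3 : 0 ≤ cubicDecay k (A * x ^ 2) t := cubicDecay_nonneg k (by positivity) t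
    exact Real.sqrt_lt_sqrt (Real.sqrt_nonneg _)
      (Real.sqrt_lt_sqrt (by positivity) (by gcongr))
  · simp [cubicDecay]
  · intro s hs t ht hst
    have := antitoneOn_cubicDecay hk (x := A * r ^ 2) (by positivity) hs ht hst
    exact Real.sqrt_le_sqrt (Real.sqrt_le_sqrt (by gcongr))
  · have := (tendsto_cubicDecay hk (x := A * r ^ 2) (by positivity)).const_mul K
    simpa using this.sqrt.sqrt

/-- The cube root is the rest level of u' = -k u³ + C d; the fourth root passes from V to the state
error. -/
theorem isClassK_gain {a K : ℝ} (ha : 0 < a) (hK : 0 < K) :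
    IsClassK fun d => √√(K * (a * d) ^ (1 / 3 : ℝ)) := by
  refine ⟨?_, ?_, by simp⟩
  · have : Continuous fun d : ℝ => (a * d) ^ (1 / 3 : ℝ) :=
      (Real.continuous_rpow_const (by norm_num)).comp (continuous_const.mul continuous_id)
    exact (continuous_const.mul this).sqrt.sqrt.continuousOn
  · intro x hx y _ hxy
    have hx0 : (0 : ℝ) ≤ x := hx
    have h1 : (a * x) ^ (1 / 3 : ℝ) < (a * y) ^ (1 / 3 : ℝ) :=
      Real.rpow_lt_rpow (by positivity) (by gcongr) (by norm_num)
    exact Real.sqrt_lt_sqrt (Real.sqrt_nonneg _)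
      (Real.sqrt_lt_sqrt (by positivity) (by gcongr))

/-! ### Input-to-state stability from a certificate -/

/-- Largest admissible attitude error for a Lyapunov certificate. -/
def LyapunovCertificate.errorBound {P : Params} {pd : E3} {c Tsup : ℝ}
    (W : LyapunovCertificate P pd c Tsup) : ℝ := min 1 (W.k * W.c₀ ^ 3 / W.C)

theorem sqrt_add_le (x y : ℝ) (hx : 0 ≤ x) (hy : 0 ≤ y) : √(x + y) ≤ √x + √y := by
  rw [Real.sqrt_le_left (by positivity), add_sq, Real.sq_sqrt hx, Real.sq_sqrt hy]
  have : 0 ≤ 2 * √x * √y := by positivity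
  linarith

section
variable {P : Params} {pd : E3} {c Tsup : ℝ} (W : LyapunovCertificate P pd c Tsup)
  {T : ℝ → ℝ} {Rd : ℝ → Mat3} {ζ : ℝ → ℝ} {a p v : ℝ → E3} {τ ζmax : ℝ}

theorem LyapunovCertificate.errorBound_pos : 0 < W.errorBound :=
  lt_min one_pos (div_pos (mul_pos W.k_pos (pow_pos W.c₀_pos 3)) W.C_pos)

theorem LyapunovCertificate.nonneg {x : E3} (hx : ‖x‖ = P.L) (u : E3) : 0 ≤ W.V x u :=
  le_trans (mul_nonneg W.l_pos.le (by positivity)) (W.lower x u hx)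

theorem LyapunovCertificate.ae_decay (hpd : ‖pd‖ = P.L)
    (h : IsOuterSolution P pd T Rd ζ a p v τ) (hζmax : ζmax ≤ W.errorBound)
    (hζ : ∀ᵐ s, s ∈ Icc 0 τ → |ζ s| < ζmax) (hTs : ∀ᵐ s, s ∈ Icc 0 τ → |T s| ≤ Tsup) :
    ∀ᵐ s, s ∈ Icc 0 τ → W.V (p s) (v s) < W.c₁ → ∃ V',
      HasDerivAt (fun s => W.V (p s) (v s)) V' s ∧
        V' ≤ -(W.k * W.V (p s) (v s) ^ 3) + W.C * |ζ s| := by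
  filter_upwards [h.ae_hasAcceleration hpd, hζ, hTs] with s hs hζs hTs' hsI hV
  obtain ⟨w, hw⟩ := hs hsI
  refine W.decay hw ((norm_disturbance_le _ (h.rotation s hsI) _ (h.unit_axis s hsI)).trans ?_)
    ((hζs hsI).le.trans (hζmax.trans (min_le_left _ _))) hV
  gcongr
  exact hTs' hsI

/-- Between c₀ and c₁ the decay k c₀³ outweighs C |ζ̃|, by the second term of `errorBound`. So V
never exceeds c₀, and the decay estimate stays available throughout. -/
theorem LyapunovCertificate.le_initial (hpd : ‖pd‖ = P.L)
    (h : IsOuterSolution P pd T Rd ζ a p v τ) (hτ : 0 ≤ τ) (hζmax : ζmax ≤ W.errorBound)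
    (hζ : ∀ᵐ s, s ∈ Icc 0 τ → |ζ s| < ζmax) (hTs : ∀ᵐ s, s ∈ Icc 0 τ → |T s| ≤ Tsup)
    (h0 : energy P pd (p 0) (v 0) ≤ c) :
    ∀ t ∈ Icc 0 τ, W.V (p t) (v t) ≤ W.c₀ := by
  have hp0 := h.on_sphere 0 ⟨le_rfl, hτ⟩
  refine AbsolutelyContinuousOnInterval.le_of_ae_deriv_nonpos hτ
    (W.absolutelyContinuous (h.absolutelyContinuous_p hτ) h.abs_cont_v)
    (W.initial _ _ hp0 h0) W.c₀_lt ?_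
  filter_upwards [W.ae_decay hpd h hζmax hζ hTs, hζ] with s hs hζs hsI hlo hhi
  obtain ⟨V', hV', hle⟩ := hs hsI hhi
  refine ⟨V', hV', hle.trans ?_⟩
  have h1 : W.k * W.c₀ ^ 3 ≤ W.k * W.V (p s) (v s) ^ 3 :=
    mul_le_mul_of_nonneg_left (pow_le_pow_left₀ W.c₀_pos.le hlo.le 3) W.k_pos.le
  have h2 : |ζ s| ≤ W.k * W.c₀ ^ 3 / W.C :=
    (hζs hsI).le.trans (hζmax.trans (min_le_right _ _))
  rw [le_div_iff₀ W.C_pos] at h2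
  linarith

/-- With u the undisturbed cubic decay and k r³ = C d, the difference V - u cannot rise above r:
there V³ ≥ (u + r)³ ≥ u³ + r³, so k V³ already compensates k u³ + C d. -/
theorem LyapunovCertificate.le_decay_add_gain (hpd : ‖pd‖ = P.L)
    (h : IsOuterSolution P pd T Rd ζ a p v τ) (hτ : 0 ≤ τ) (hζmax : ζmax ≤ W.errorBound)
    (hζ : ∀ᵐ s, s ∈ Icc 0 τ → |ζ s| < ζmax) (hTs : ∀ᵐ s, s ∈ Icc 0 τ → |T s| ≤ Tsup)
    (h0 : energy P pd (p 0) (v 0) ≤ c) {t d : ℝ} (ht : t ∈ Icc 0 τ) (hd0 : 0 ≤ d)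
    (hd : ∀ᵐ s, s ∈ Icc 0 t → |ζ s| ≤ d) :
    W.V (p t) (v t) ≤
      cubicDecay W.k (W.V (p 0) (v 0)) t + (W.C / W.k * d) ^ (1 / 3 : ℝ) := by
  have hk := W.k_pos
  have hC := W.C_pos
  have hV0 := W.nonneg (h.on_sphere 0 ⟨le_rfl, hτ⟩) (v 0)
  set r := (W.C / W.k * d) ^ (1 / 3 : ℝ) with hr
  have hr0 : 0 ≤ r := by positivity
  have hr3 : W.k * r ^ 3 = W.C * d := by
    rw [hr, ← Real.rpow_natCast, ← Real.rpow_mul (by positivity)]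
    norm_num
    field_simp
  set x := W.V (p 0) (v 0) with hx
  have hu : ∀ s ∈ Icc 0 t, HasDerivAt (cubicDecay W.k x) (-(W.k * cubicDecay W.k x s ^ 3)) s :=
    fun s hs => hasDerivAt_cubicDecay hk x hs.1
  have hule : ∀ s ∈ Icc 0 t, cubicDecay W.k x s ≤ x := fun s hs => by
    have := antitoneOn_cubicDecay hk hV0 (mem_Ici.2 le_rfl) (mem_Ici.2 hs.1) hs.1
    rwa [cubicDecay_zero] at this
  have hac : AbsolutelyContinuousOnInterval (cubicDecay W.k x) 0 t := by
    refine .of_hasDerivWithinAt (C := W.k * x ^ 3) ht.1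
      (fun s hs => (hu s hs).hasDerivWithinAt) fun s hs => ?_
    have h1 := cubicDecay_nonneg W.k hV0 s
    rw [norm_neg, Real.norm_of_nonneg (by positivity)]
    gcongr
    exact hule s hs
  have hVac : AbsolutelyContinuousOnInterval (fun s => W.V (p s) (v s)) 0 t := by
    refine (W.absolutelyContinuous (h.absolutelyContinuous_p hτ) h.abs_cont_v).mono ?_
    rw [uIcc_of_le ht.1, uIcc_of_le hτ]
    exact Icc_subset_Icc_right ht.2
  have key := AbsolutelyContinuousOnInterval.le_of_ae_deriv_nonpos (c₀ := r) (c₁ := r + 1) ht.1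
    (hVac.fun_sub hac) (by rw [cubicDecay_zero, ← hx, sub_self]; exact hr0) (by linarith) (by
      filter_upwards [W.ae_decay hpd h hζmax hζ hTs, hd] with s hs hds hsI hlo _
      have hsI' : s ∈ Icc 0 τ := ⟨hsI.1, hsI.2.trans ht.2⟩
      obtain ⟨V', hV', hle⟩ := hs hsI'
        ((W.le_initial hpd h hτ hζmax hζ hTs h0 s hsI').trans_lt W.c₀_lt)
      refine ⟨_, hV'.sub (hu s hsI), ?_⟩
      have hu0 := cubicDecay_nonneg W.k hV0 s
      generalize cubicDecay W.k x s = u at *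
      have h1 : (u + r) ^ 3 ≤ W.V (p s) (v s) ^ 3 :=
        pow_le_pow_left₀ (by positivity) (by linarith) 3
      have h2 : u ^ 3 + r ^ 3 ≤ (u + r) ^ 3 := by
        have : 0 ≤ 3 * u ^ 2 * r + 3 * u * r ^ 2 := by positivity
        linarith
      have h3 := mul_le_mul_of_nonneg_left (h2.trans h1) hk.le
      have h4 := mul_le_mul_of_nonneg_left (hds hsI) hC.le
      linarith) t ⟨ht.1, le_rfl⟩
  linarith

theorem LyapunovCertificate.iss (hpd : ‖pd‖ = P.L) (hζmax : ζmax ≤ W.errorBound) :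
    ISSWithRestriction P pd {x | ‖x.1‖ = P.L ∧ energy P pd x.1 x.2 ≤ c} ζmax Tsup := by
  have hk := W.k_pos
  have hC := W.C_pos
  have hA := W.A_pos
  have hl := W.l_pos
  have hL := P.L_pos
  have hc₀ := W.c₀_pos
  -- From e² = 2 L² N + ‖v‖² follows e⁴ ≤ 8 L⁴ N² + 2 ‖v‖⁴, and ‖v‖² ≤ c₀ / l reduces ‖v‖⁴ to ‖v‖².
  set K := (8 * P.L ^ 4 + 2 * (W.c₀ / W.l)) / W.l with hK
  have hK0 : 0 < K := by positivity
  set A' := W.A * (1 + 1 / (2 * P.L ^ 2)) with hA'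
  have hA'0 : 0 < A' := by positivity
  refine ⟨_, _, isClassKL_sqrt_sqrt_cubicDecay hk hK0 hA'0, isClassK_gain (div_pos hC hk) hK0, ?_⟩
  intro T Rd ζ a p v τ hτ h h0 hζ hTs t ht d hd0 hd
  have hV := W.le_decay_add_gain hpd h hτ.le hζmax hζ hTs h0.2 ht hd0 hd
  have hVc := W.le_initial hpd h hτ.le hζmax hζ hTs h0.2 t ht
  have hV0 := W.upper (p 0) (v 0) h0.1
  have hpt := h.on_sphere t ht
  have hlo := W.lower (p t) (v t) hpt
  have hN0 := one_sub_cosAngle_mem hpd h0.1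
  have hN := one_sub_cosAngle_mem hpd hpt
  have he0 := stateError_sq (v := v 0) hpd h0.1
  have he := stateError_sq (v := v t) hpd hpt
  have h1 : W.V (p 0) (v 0) ≤ A' * stateError pd (p 0) (v 0) ^ 2 := by
    refine hV0.trans ?_
    rw [he0, hA', mul_assoc]
    gcongr
    have e : (1 + 1 / (2 * P.L ^ 2)) * (2 * P.L ^ 2 * (1 - cosAngle P pd (p 0)) + ‖v 0‖ ^ 2)
        = ‖v 0‖ ^ 2 + (1 - cosAngle P pd (p 0)) + (2 * P.L ^ 2 * (1 - cosAngle P pd (p 0))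
          + 1 / (2 * P.L ^ 2) * ‖v 0‖ ^ 2) := by field_simp; ring
    have : 0 ≤ 2 * P.L ^ 2 * (1 - cosAngle P pd (p 0)) := mul_nonneg (by positivity) hN0.1
    have : 0 ≤ 1 / (2 * P.L ^ 2) * ‖v 0‖ ^ 2 := by positivity
    linarith
  have h2 := cubicDecay_mono hk (W.nonneg h0.1 (v 0)) h1 ht.1
  have hvn : ‖v t‖ ^ 2 ≤ W.c₀ / W.l := by
    rw [le_div_iff₀ hl]
    linarith [mul_nonneg hl.le (sq_nonneg (1 - cosAngle P pd (p t)))]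
  have h3 : stateError pd (p t) (v t) ^ 4 ≤ K * W.V (p t) (v t) := by
    have h4 : ‖v t‖ ^ 2 + (1 - cosAngle P pd (p t)) ^ 2 ≤ W.V (p t) (v t) / W.l := by
      rw [le_div_iff₀ hl]; linarith
    have e : K * W.V (p t) (v t)
        = (8 * P.L ^ 4 + 2 * (W.c₀ / W.l)) * (W.V (p t) (v t) / W.l) := by
      rw [hK]; field_simp
    rw [e]
    refine le_trans ?_ (mul_le_mul_of_nonneg_left h4 (by positivity))
    have e2 : stateError pd (p t) (v t) ^ 4 = (stateError pd (p t) (v t) ^ 2) ^ 2 := by ring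
    rw [e2, he]
    have hv0 := sq_nonneg ‖v t‖
    generalize ‖v t‖ ^ 2 = n at *
    generalize 1 - cosAngle P pd (p t) = N at *
    generalize W.c₀ / W.l = b at *
    have h5 : n * n ≤ b * n := mul_le_mul_of_nonneg_right hvn hv0
    have h6 : 0 ≤ 8 * P.L ^ 4 * n := by positivity
    have h7 : 0 ≤ b * N ^ 2 := mul_nonneg (hv0.trans hvn) (sq_nonneg N)
    have h8 := sq_nonneg (2 * P.L ^ 2 * N - n)
    linarith
  have he0 : 0 ≤ stateError pd (p t) (v t) := Real.sqrt_nonneg _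
  have h4 : stateError pd (p t) (v t) = √√(stateError pd (p t) (v t) ^ 4) := by
    rw [show stateError pd (p t) (v t) ^ 4 = (stateError pd (p t) (v t) ^ 2) ^ 2 by ring,
      Real.sqrt_sq (sq_nonneg _), Real.sqrt_sq he0]
  have h5 : 0 ≤ cubicDecay W.k (A' * stateError pd (p 0) (v 0) ^ 2) t :=
    cubicDecay_nonneg _ (by positivity) t
  have h6 : 0 ≤ (W.C / W.k * d) ^ (1 / 3 : ℝ) := by positivity
  rw [h4]
  refine (Real.sqrt_le_sqrt (Real.sqrt_le_sqrt (h3.trans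
    (mul_le_mul_of_nonneg_left (hV.trans (add_le_add_left h2 _)) hK0.le)))).trans ?_
  rw [mul_add]
  exact (Real.sqrt_le_sqrt (sqrt_add_le _ _ (by positivity) (by positivity))).trans
    (sqrt_add_le _ _ (Real.sqrt_nonneg _) (Real.sqrt_nonneg _))

end

/-! ### Linear ultimate bound near the equilibrium -/

/-- The slow variable of the outer loop near the equilibrium, where the damping dominates. -/
def slowVar (P : Params) (pd x u : E3) : ℝ :=
  P.Kd * P.L ^ 2 * (1 - cosAngle P pd x) - P.m * inner ℝ u pd

/-- Bound of the proportional force relative to `1 - cosAngle`. -/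
def forceBound (P : Params) : ℝ := P.L ^ 3 * (P.Kp * P.L / P.μ * (Real.pi ^ 2 / 2))

section
variable {P : Params} {pd δ w x u : E3} {p v : ℝ → E3} {t : ℝ}

theorem forceBound_pos (P : Params) : 0 < forceBound P := by
  have := P.Kp_pos; have := P.μ_pos; have := Real.pi_pos; have := P.L_pos
  unfold forceBound; positivity

theorem abs_inner_desired_le_sqrt (hpd : ‖pd‖ = P.L) (hx : ‖x‖ = P.L)
    (hu : inner ℝ x u = (0 : ℝ)) :
    |inner ℝ u pd| ≤ P.L * √(1 - cosAngle P pd x ^ 2) * ‖u‖ := by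
  have hL := P.L_pos
  have h := inner_sq_le hpd hx hu
  have h2 : 0 ≤ 1 - cosAngle P pd x ^ 2 := by
    have := (sq_le_one_iff_abs_le_one _).2 (abs_cosAngle_le hpd hx); linarith
  refine abs_le_of_sq_le_sq ?_ (by positivity)
  rw [mul_pow, mul_pow, Real.sq_sqrt h2]; linarith

theorem norm_proportional_le (hpd : ‖pd‖ = P.L) (hx : ‖x‖ = P.L) :
    ‖(P.L ^ 2 * pdGain P (cosAngle P pd x)) • (pd - cosAngle P pd x • x)‖
      ≤ forceBound P * (1 - cosAngle P pd x) := by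
  have hL := P.L_pos
  rw [norm_smul, norm_sub_cosAngle_smul hpd hx, Real.norm_of_nonneg
    (mul_nonneg (by positivity) (pdGain_nonneg P _)), forceBound]
  have := mul_le_mul_of_nonneg_left (pdGain_mul_sqrt_le P (abs_cosAngle_le hpd hx))
    (pow_pos hL 3).le
  linarith

theorem HasAcceleration.speed_deriv_le (h : HasAcceleration P pd δ p v w t) (hpd : ‖pd‖ = P.L)
    (hv : v t ≠ 0) :
    ∃ s', HasDerivAt (fun s => ‖v s‖) s' t ∧
      P.m * s' ≤ forceBound P * (1 - cosAngle P pd (p t)) - P.Kd * ‖v t‖ + ‖δ‖ := by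
  have hn : 0 < ‖v t‖ := norm_pos_iff.2 hv
  have h1 := h.deriv_v.norm_sq.sqrt (pow_pos hn 2).ne'
  simp only [Real.sqrt_sq (norm_nonneg _)] at h1
  refine ⟨_, h1, ?_⟩
  have hs := norm_proportional_le hpd h.norm_p
  set F := (P.L ^ 2 * pdGain P (cosAngle P pd (p t))) • (pd - cosAngle P pd (p t) • p t) with hF
  have h2 : P.L ^ 2 * pdGain P (cosAngle P pd (p t)) * inner ℝ (v t) pd = inner ℝ (v t) F := by
    rw [hF, real_inner_smul_right, inner_sub_right, real_inner_smul_right,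
      real_inner_comm (p t) (v t), h.tangent]; ring
  have h3 := real_inner_le_norm (v t) F
  have h4 := real_inner_le_norm (v t) δ
  have h5 := mul_le_mul_of_nonneg_left hs hn.le
  have h6 := h.mass_mul_inner_velocity
  rw [h2] at h6
  have e : P.m * (2 * inner ℝ (v t) w / (2 * ‖v t‖)) = P.m * inner ℝ (v t) w / ‖v t‖ := by
    field_simp
  rw [e, div_le_iff₀ hn, h6]
  linarith

/-- The damping contributions Kd ⟨v, pd⟩ of the two summands cancel. What remains is the restoring
force, at least of order σ³ for σ = √(1 - y²), the disturbance and the centripetal term. -/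
theorem HasAcceleration.slowVar_deriv_le (h : HasAcceleration P pd δ p v w t)
    (hpd : ‖pd‖ = P.L) :
    ∃ s', HasDerivAt (fun s => slowVar P pd (p s) (v s)) s' t ∧
      s' ≤ -(P.L ^ 4 * gainSlope P * √(1 - cosAngle P pd (p t) ^ 2) ^ 3)
        + P.L * √(1 - cosAngle P pd (p t) ^ 2) * ‖δ‖ + P.m * ‖v t‖ ^ 2 := by
  have hL := P.L_pos
  have h1 := (h.hasDerivAt_cosAngle.const_sub 1).const_mul (P.Kd * P.L ^ 2)
  have h2 := (h.deriv_v.inner ℝ (hasDerivAt_const t pd)).const_mul P.m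
  refine ⟨_, h1.sub h2, ?_⟩
  have hy := abs_cosAngle_le hpd h.norm_p
  have hw := h.mass_mul_inner_desired hpd
  have h3 := (neg_le_abs _).trans (abs_inner_sub_le (δ := δ) hpd h.norm_p)
  have h4 := gainSlope_mul_sqrt_le P (cosAngle P pd (p t))
  have hq : 0 ≤ 1 - cosAngle P pd (p t) ^ 2 := by
    have := (sq_le_one_iff_abs_le_one _).2 hy; linarith
  have h5 : P.L ^ 4 * gainSlope P * √(1 - cosAngle P pd (p t) ^ 2) ^ 3
      ≤ P.L ^ 4 * pdGain P (cosAngle P pd (p t)) * (1 - cosAngle P pd (p t) ^ 2) := by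
    have := mul_le_mul_of_nonneg_left h4 (mul_nonneg (pow_pos hL 4).le hq)
    calc _ = P.L ^ 4 * √(1 - cosAngle P pd (p t) ^ 2) ^ 2
          * (gainSlope P * √(1 - cosAngle P pd (p t) ^ 2)) := by ring
      _ ≤ _ := by rw [Real.sq_sqrt hq]; linarith
  have h6 : -(P.m * ‖v t‖ ^ 2 * -cosAngle P pd (p t)) ≤ P.m * ‖v t‖ ^ 2 := by
    have : 0 ≤ P.m * ‖v t‖ ^ 2 := mul_nonneg P.m_pos.le (sq_nonneg _)
    nlinarith [(abs_le.1 hy).2]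
  simp only [inner_zero_right, zero_add]
  have e : P.Kd * P.L ^ 2 * -(inner ℝ (v t) pd / P.L ^ 2) = -(P.Kd * inner ℝ (v t) pd) := by
    field_simp
  rw [e, hw]
  linarith

theorem absolutelyContinuous_slowVar {a b : ℝ} (hp : AbsolutelyContinuousOnInterval p a b)
    (hv : AbsolutelyContinuousOnInterval v a b) :
    AbsolutelyContinuousOnInterval (fun s => slowVar P pd (p s) (v s)) a b := by
  have hy := hp.comp_lipschitz (lipschitzWith_cosAngle P pd)
  have h3 := hv.comp_lipschitz (lipschitzWith_inner_right pd)
  have h4 := (absolutelyContinuous_const 1 a b).fun_sub hy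
  exact (h4.const_mul (P.Kd * P.L ^ 2)).fun_sub (h3.const_mul P.m)

theorem ae_ge_of_forall_ae_Icc {q : ℝ → Prop} {t₀ : ℝ}
    (h : ∀ τ, t₀ ≤ τ → ∀ᵐ t, t ∈ Icc t₀ τ → q t) : ∀ᵐ t, t₀ ≤ t → q t := by
  have h1 : ∀ᵐ t, ∀ n : ℕ, t ∈ Icc t₀ (t₀ + n) → q t :=
    ae_all_iff.2 fun n => h _ (by simp)
  filter_upwards [h1] with t ht h0
  obtain ⟨n, hn⟩ := exists_nat_ge (t - t₀)
  exact ht n ⟨h0, by linarith⟩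

/-- Near the equilibrium, speed and `1 - cosAngle` are ultimately bounded by a multiple of the
disturbance: the proportional force is quadratic in the distance, so the gain is linear. -/
theorem exists_linear_ultimate_bound (P : Params) :
    ∃ r ν κ : ℝ, 0 < r ∧ 0 < ν ∧ 0 < κ ∧ ∀ (pd : E3) (p v δ : ℝ → E3) (t₀ c : ℝ), ‖pd‖ = P.L →
      0 < c →
      (∀ τ, t₀ ≤ τ → AbsolutelyContinuousOnInterval p t₀ τ) →
      (∀ τ, t₀ ≤ τ → AbsolutelyContinuousOnInterval v t₀ τ) →
      (∀ᵐ t, t₀ ≤ t → ∃ w, HasAcceleration P pd (δ t) p v w t) →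
      (∀ t, t₀ ≤ t → ‖p t‖ = P.L ∧ inner ℝ (p t) (v t) = (0 : ℝ)) →
      (∀ t, t₀ ≤ t → 1 - cosAngle P pd (p t) ≤ ν) →
      (∀ᵐ t, t₀ ≤ t → ‖δ t‖ ≤ κ * c) →
      ∃ t₁, t₀ ≤ t₁ ∧ ∀ t, t₁ ≤ t → ‖v t‖ ≤ r * c ∧ 1 - cosAngle P pd (p t) ≤ r * c := by
  have hm := P.m_pos
  have hL := P.L_pos
  have hKd := P.Kd_pos
  have hb := gainSlope_pos P
  have hF := forceBound_pos P
  -- Where lam ‖v‖ dominates the slow variable, N ≤ 3 lam ‖v‖ / (2 Kd L²); this lam makes the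
  -- proportional force at most Kd/2 ‖v‖ there.
  set lam := P.Kd ^ 2 * P.L ^ 2 / (3 * forceBound P) with hlam
  have hlam0 : 0 < lam := by positivity
  -- The neighbourhood is so small that m |⟨v, pd⟩| ≤ lam/2 ‖v‖, and that in the slow regime the
  -- centripetal term is at most half of the restoring term.
  obtain ⟨ν, hν0, hν1, hν2, hν3⟩ : ∃ ν : ℝ, 0 < ν ∧ ν ≤ 1 ∧ P.m * P.L * √(2 * ν) ≤ lam / 2 ∧
      P.m * (2 * P.Kd * P.L ^ 2 / lam) ^ 2 * √ν ≤ gainSlope P * P.L ^ 4 / 2 := by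
    have hpos : ∀ᶠ ε in 𝓝[>] (0 : ℝ), 0 < ε := self_mem_nhdsWithin
    obtain ⟨ν, h0, h1, h2, h3⟩ := (hpos.and <|
      (eventually_nhdsGT_zero_lt (f := fun ν => ν) (by fun_prop) rfl one_pos).and <|
      (eventually_nhdsGT_zero_lt (f := fun ν => P.m * P.L * √(2 * ν)) (x := lam / 2)
        (by fun_prop) (by simp) (by positivity)).and
      (eventually_nhdsGT_zero_lt (f := fun ν => P.m * (2 * P.Kd * P.L ^ 2 / lam) ^ 2 * √ν)
        (x := gainSlope P * P.L ^ 4 / 2) (by fun_prop) (by simp) (by positivity))).exists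
    exact ⟨ν, h0, h1.le, h2.le, h3.le⟩
  -- The first bound lets the damping absorb δ in the fast regime; the second lets the restoring
  -- term absorb it in the slow one.
  set κ := min (P.Kd / (4 * lam)) (gainSlope P * P.L / (8 * P.Kd)) with hκ
  have hκ0 : 0 < κ := lt_min (by positivity) (by positivity)
  -- From lam ‖v‖ ≤ c and slow variable ≤ c: Kd L² N ≤ c + lam/2 ‖v‖ ≤ 3c/2.
  refine ⟨max (1 / lam) (3 / (2 * (P.Kd * P.L ^ 2))), ν, κ, lt_max_of_lt_left (by positivity), hν0,
    hκ0, ?_⟩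
  intro pd p v δ t₀ c hpd hc hpac hvac hacc hstate hνt hδ
  set Q : ℝ → ℝ := fun t => max (lam * ‖v t‖) (slowVar P pd (p t) (v t)) with hQ
  have hQac : ∀ τ, t₀ ≤ τ → AbsolutelyContinuousOnInterval Q t₀ τ := fun τ hτ =>
    (((hvac τ hτ).comp_lipschitz lipschitzWith_one_norm).const_mul lam).max
      (absolutelyContinuous_slowVar (hpac τ hτ) (hvac τ hτ))
  have hcross : ∀ t, t₀ ≤ t → |P.m * inner ℝ (v t) pd| ≤ lam / 2 * ‖v t‖ := by
    intro t ht
    have h1 := abs_inner_desired_le_sqrt hpd (hstate t ht).1 (hstate t ht).2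
    have h2 : √(1 - cosAngle P pd (p t) ^ 2) ≤ √(2 * ν) := by
      apply Real.sqrt_le_sqrt
      have := hνt t ht
      nlinarith [sq_nonneg (1 - cosAngle P pd (p t))]
    rw [abs_mul, abs_of_pos hm]
    calc P.m * |inner ℝ (v t) pd| ≤ P.m * (P.L * √(2 * ν) * ‖v t‖) := by
          refine mul_le_mul_of_nonneg_left (h1.trans ?_) hm.le
          gcongr
      _ = P.m * P.L * √(2 * ν) * ‖v t‖ := by ring
      _ ≤ lam / 2 * ‖v t‖ := by gcongr
  -- In the slow regime Q > c forces N ≥ σ₀² and σ ≥ σ₀, so the restoring term has a definite size.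
  set σ₀ := √(c / (2 * P.Kd * P.L ^ 2)) with hσ₀
  have hσ₀0 : 0 < σ₀ := Real.sqrt_pos.2 (by positivity)
  set η := min (P.Kd * c / (4 * P.m)) (gainSlope P * P.L ^ 4 / 4 * σ₀ ^ 3) with hη
  have hη0 : 0 < η := lt_min (by positivity) (by positivity)
  have hdiff : ∀ᵐ t, t₀ ≤ t → DifferentiableAt ℝ Q t := ae_ge_of_forall_ae_Icc fun τ hτ => by
    have := (hQac τ hτ).ae_differentiableAt
    rwa [uIcc_of_le hτ] at this
  obtain ⟨t₁, ht₁, hle⟩ := AbsolutelyContinuousOnInterval.eventually_le_of_ae_deriv_le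
    (f := Q) (c := c) (B := 0) hη0 hQac
    (fun t _ => le_max_of_le_left (mul_nonneg hlam0.le (norm_nonneg _))) (by
    filter_upwards [hacc, hδ, hdiff] with t h1 h2 h3 ht hQc
    obtain ⟨w, hw⟩ := h1 ht
    have hD := h2 ht
    have hQd := (h3 ht).hasDerivAt
    have hcr := abs_le.1 (hcross t ht)
    have hN := one_sub_cosAngle_mem hpd hw.norm_p
    -- Where the maximum Q is differentiable and a branch f attains it, Q - f has a minimum, so the
    -- derivatives agree; no separate treatment of ties is needed.
    have hbr : ∀ (f : ℝ → ℝ) (f' : ℝ), HasDerivAt f f' t → (∀ s, f s ≤ Q s) → f t = Q t →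
        deriv Q t = f' := by
      intro f f' hf hfQ hft
      have hmin : IsLocalMin (fun s => Q s - f s) t := Eventually.of_forall fun s => by
        have := hfQ s
        simp only [hft, sub_self]; linarith
      have := hmin.hasDerivAt_eq_zero (hQd.sub hf)
      linarith
    refine ⟨deriv Q t, hQd, ?_⟩
    rcases le_total (slowVar P pd (p t) (v t)) (lam * ‖v t‖) with hcase | hcase
    · have hQt : lam * ‖v t‖ = Q t := (max_eq_left hcase).symm
      rw [← hQt] at hQc
      have hn : 0 < ‖v t‖ := by
        by_contra! hneg
        nlinarith
      obtain ⟨s', hs', hs'le⟩ := hw.speed_deriv_le hpd (norm_pos_iff.1 hn)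
      rw [hbr _ _ (hs'.const_mul lam) (fun s => le_max_left _ _) hQt]
      have hN2 : P.Kd * P.L ^ 2 * (1 - cosAngle P pd (p t)) ≤ 3 / 2 * lam * ‖v t‖ := by
        rw [slowVar] at hcase; linarith
      have hN3 : forceBound P * (1 - cosAngle P pd (p t)) ≤ P.Kd / 2 * ‖v t‖ := by
        have h4 := mul_le_mul_of_nonneg_left hN2 (a := forceBound P / (P.Kd * P.L ^ 2))
          (by positivity)
        have e1 : forceBound P / (P.Kd * P.L ^ 2) * (P.Kd * P.L ^ 2 * (1 - cosAngle P pd (p t)))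
            = forceBound P * (1 - cosAngle P pd (p t)) := by field_simp
        have e2 : forceBound P / (P.Kd * P.L ^ 2) * (3 / 2 * lam * ‖v t‖)
            = P.Kd / 2 * ‖v t‖ := by rw [hlam]; field_simp
        rwa [e1, e2] at h4
      have hD2 : ‖δ t‖ ≤ P.Kd / 4 * ‖v t‖ := by
        calc ‖δ t‖ ≤ κ * c := hD
          _ ≤ P.Kd / (4 * lam) * (lam * ‖v t‖) := by
            gcongr
            exact min_le_left _ _
          _ = _ := by field_simp
      have h5 : P.m * s' ≤ -(P.Kd / 4 * ‖v t‖) := by linarith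
      have h6 : lam * s' ≤ -(P.Kd * c / (4 * P.m)) := by
        have h7 : lam * s' = lam / P.m * (P.m * s') := by field_simp
        have h8 := mul_le_mul_of_nonneg_left h5 (a := lam / P.m) (by positivity)
        have h9 : P.Kd * c / (4 * P.m) ≤ lam / P.m * (P.Kd / 4 * ‖v t‖) := by
          have : lam / P.m * (P.Kd / 4 * ‖v t‖) = P.Kd * (lam * ‖v t‖) / (4 * P.m) := by
            field_simp
          rw [this]
          gcongr
        linarith
      linarith [min_le_left (P.Kd * c / (4 * P.m)) (gainSlope P * P.L ^ 4 / 4 * σ₀ ^ 3)]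
    · have hQt : slowVar P pd (p t) (v t) = Q t := (max_eq_right hcase).symm
      rw [← hQt] at hQc
      obtain ⟨s', hs', hs'le⟩ := hw.slowVar_deriv_le hpd
      rw [hbr _ _ hs' (fun s => le_max_right _ _) hQt]
      have hM : slowVar P pd (p t) (v t) ≤ 2 * (P.Kd * P.L ^ 2 * (1 - cosAngle P pd (p t))) := by
        have : slowVar P pd (p t) (v t) = P.Kd * P.L ^ 2 * (1 - cosAngle P pd (p t))
          - P.m * inner ℝ (v t) pd := rfl
        linarith
      have hν' := hνt t ht
      have hσN : 1 - cosAngle P pd (p t) ≤ 1 - cosAngle P pd (p t) ^ 2 := by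
        have : 0 ≤ cosAngle P pd (p t) := by linarith
        nlinarith [hN.1]
      have hσ2 := Real.sq_sqrt (hN.1.trans hσN)
      have hσσ : 0 ≤ √(1 - cosAngle P pd (p t) ^ 2) := Real.sqrt_nonneg _
      rw [← hσ2] at hσN
      generalize √(1 - cosAngle P pd (p t) ^ 2) = σ at *
      generalize 1 - cosAngle P pd (p t) = N at *
      have hn : ‖v t‖ ≤ 2 * P.Kd * P.L ^ 2 / lam * N := by
        rw [div_mul_eq_mul_div, le_div_iff₀ hlam0]; linarith
      have hNc : c / (2 * P.Kd * P.L ^ 2) ≤ N := by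
        rw [div_le_iff₀ (by positivity)]; linarith
      have hσ₀σ : σ₀ ≤ σ := (Real.sqrt_le_left hσσ).2 (hNc.trans hσN)
      -- Since ‖v‖ is O(N) here, this makes the centripetal term a small multiple of σ³; it uses N ≤
      -- ν and N ≤ σ².
      have hN2 : N ^ 2 ≤ √ν * σ ^ 3 := by
        have h4 : √N ≤ √ν := Real.sqrt_le_sqrt hν'
        have h5 : √N ≤ σ := (Real.sqrt_le_left hσσ).2 hσN
        have h6 := Real.sq_sqrt hN.1
        calc N ^ 2 = √N * N * √N := by linear_combination (-N) * h6
          _ ≤ √ν * σ ^ 2 * σ := by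
            have := hN.1
            gcongr
          _ = _ := by ring
      have hkin : P.m * ‖v t‖ ^ 2 ≤ gainSlope P * P.L ^ 4 / 2 * σ ^ 3 := by
        calc P.m * ‖v t‖ ^ 2 ≤ P.m * (2 * P.Kd * P.L ^ 2 / lam * N) ^ 2 := by gcongr
          _ = P.m * (2 * P.Kd * P.L ^ 2 / lam) ^ 2 * N ^ 2 := by ring
          _ ≤ P.m * (2 * P.Kd * P.L ^ 2 / lam) ^ 2 * (√ν * σ ^ 3) := by gcongr
          _ = P.m * (2 * P.Kd * P.L ^ 2 / lam) ^ 2 * √ν * σ ^ 3 := by ring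
          _ ≤ _ := by gcongr
      have hdis : P.L * σ * ‖δ t‖ ≤ gainSlope P * P.L ^ 4 / 4 * σ ^ 3 := by
        have h4 : P.L * ‖δ t‖ ≤ gainSlope P * P.L ^ 4 / 4 * σ ^ 2 := by
          calc P.L * ‖δ t‖ ≤ P.L * (gainSlope P * P.L / (8 * P.Kd) * c) := by
                refine mul_le_mul_of_nonneg_left (hD.trans ?_) hL.le
                gcongr
                exact min_le_right _ _
            _ = gainSlope P * P.L ^ 4 / 4 * (c / (2 * P.Kd * P.L ^ 2)) := by field_simp; ring
            _ ≤ _ := by gcongr; exact hNc.trans hσN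
        have := mul_le_mul_of_nonneg_left h4 hσσ
        linarith
      have hσ3 : gainSlope P * P.L ^ 4 / 4 * σ₀ ^ 3 ≤ gainSlope P * P.L ^ 4 / 4 * σ ^ 3 := by
        gcongr
      linarith [min_le_right (P.Kd * c / (4 * P.m)) (gainSlope P * P.L ^ 4 / 4 * σ₀ ^ 3)])
  refine ⟨t₁, ht₁, fun t ht => ?_⟩
  have ht0 := ht₁.trans ht
  have h1 : lam * ‖v t‖ ≤ c := (le_max_left _ _).trans (hle t ht)
  have h2 : slowVar P pd (p t) (v t) ≤ c := (le_max_right _ _).trans (hle t ht)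
  have hcr := abs_le.1 (hcross t ht0)
  constructor
  · calc ‖v t‖ ≤ 1 / lam * c := by rw [one_div_mul_eq_div, le_div_iff₀ hlam0]; linarith
      _ ≤ _ := by gcongr; exact le_max_left _ _
  · calc 1 - cosAngle P pd (p t) ≤ 3 / (2 * (P.Kd * P.L ^ 2)) * c := by
          rw [div_mul_eq_mul_div, le_div_iff₀ (by positivity)]
          rw [slowVar] at h2; linarith
      _ ≤ _ := by gcongr; exact le_max_right _ _

end

/-! ### Solutions on the half-line -/

section
variable {P : Params} {pd : E3} {T : ℝ → ℝ} {Rd : ℝ → Mat3} {ζ : ℝ → ℝ} {a p v : ℝ → E3}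

theorem absolutelyContinuous_p_of_forall (h : ∀ τ, 0 < τ → IsOuterSolution P pd T Rd ζ a p v τ)
    {t₀ τ : ℝ} (h0 : 0 ≤ t₀) (hτ : t₀ ≤ τ) : AbsolutelyContinuousOnInterval p t₀ τ := by
  have hτ1 : 0 < τ + 1 := by linarith
  refine ((h _ hτ1).absolutelyContinuous_p hτ1.le).mono ?_
  rw [uIcc_of_le hτ, uIcc_of_le hτ1.le]
  exact Icc_subset_Icc h0 (by linarith)

theorem absolutelyContinuous_v_of_forall (h : ∀ τ, 0 < τ → IsOuterSolution P pd T Rd ζ a p v τ)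
    {t₀ τ : ℝ} (h0 : 0 ≤ t₀) (hτ : t₀ ≤ τ) : AbsolutelyContinuousOnInterval v t₀ τ := by
  have hτ1 : 0 < τ + 1 := by linarith
  refine (h _ hτ1).abs_cont_v.mono ?_
  rw [uIcc_of_le hτ, uIcc_of_le hτ1.le]
  exact Icc_subset_Icc h0 (by linarith)

theorem norm_p_of_forall (h : ∀ τ, 0 < τ → IsOuterSolution P pd T Rd ζ a p v τ) {t : ℝ}
    (ht : 0 ≤ t) : ‖p t‖ = P.L :=
  (h (t + 1) (by linarith)).on_sphere t ⟨ht, by linarith⟩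

theorem hasDerivAt_p_of_forall (h : ∀ τ, 0 < τ → IsOuterSolution P pd T Rd ζ a p v τ) {t : ℝ}
    (ht : 0 < t) : HasDerivAt p (v t) t :=
  ((h (t + 1) (by linarith)).deriv_p t ⟨ht.le, by linarith⟩).hasDerivAt
    (Icc_mem_nhds ht (by linarith))

theorem tangent_of_forall (h : ∀ τ, 0 < τ → IsOuterSolution P pd T Rd ζ a p v τ) {t : ℝ}
    (ht : 0 < t) : inner ℝ (p t) (v t) = (0 : ℝ) := by
  have h1 := (hasDerivAt_p_of_forall h ht).norm_sq
  have h2 : (fun x => ‖p x‖ ^ 2) =ᶠ[𝓝 t] fun _ => P.L ^ 2 := by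
    filter_upwards [lt_mem_nhds ht] with x hx
    rw [norm_p_of_forall h hx.le]
  have := (h1.congr_of_eventuallyEq h2.symm).unique (hasDerivAt_const t (P.L ^ 2))
  linarith

theorem ae_hasAcceleration_of_forall (h : ∀ τ, 0 < τ → IsOuterSolution P pd T Rd ζ a p v τ)
    (hpd : ‖pd‖ = P.L) :
    ∀ᵐ t, 0 ≤ t →
      ∃ w, HasAcceleration P pd (disturbance (T t) (Rd t) (ζ t) (a t)) p v w t :=
  ae_ge_of_forall_ae_Icc fun τ hτ => by
    filter_upwards [(h (τ + 1) (by linarith)).ae_hasAcceleration hpd] with t ht htI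
    exact ht ⟨htI.1, htI.2.trans (by linarith)⟩

/-- The transient falls below ρ/2, and `hζρ` makes the residual (C ζmax / k)^(1/3) at most ρ/2. -/
theorem LyapunovCertificate.eventually_le {c Tsup ρ ζmax : ℝ}
    (W : LyapunovCertificate P pd c Tsup) (hpd : ‖pd‖ = P.L)
    (h : ∀ τ, 0 < τ → IsOuterSolution P pd T Rd ζ a p v τ) (hρ : 0 < ρ) (hζ0 : 0 ≤ ζmax)
    (hζmax : ζmax ≤ W.errorBound) (hζρ : ζmax ≤ W.k / W.C * (ρ / 2) ^ 3)
    (hζ : ∀ᵐ s, 0 ≤ s → |ζ s| < ζmax) (hTs : ∀ᵐ s, 0 ≤ s → |T s| ≤ Tsup)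
    (h0 : energy P pd (p 0) (v 0) ≤ c) :
    ∃ t₁, 0 < t₁ ∧ ∀ t, t₁ ≤ t → W.V (p t) (v t) ≤ ρ := by
  have hk := W.k_pos
  have hC := W.C_pos
  have hlim := tendsto_cubicDecay hk (W.nonneg (norm_p_of_forall h le_rfl) (v 0))
  have hev := hlim.eventually (gt_mem_nhds (by positivity : 0 < ρ / 2))
  obtain ⟨t₁, ht₁⟩ := eventually_atTop.1 hev
  refine ⟨max t₁ 1, lt_max_of_lt_right one_pos, fun t ht => ?_⟩
  have htpos : 0 < t := lt_of_lt_of_le (lt_max_of_lt_right one_pos) ht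
  have hb := W.le_decay_add_gain hpd (h t htpos) htpos.le hζmax
    (by filter_upwards [hζ] with s hs hsI using hs hsI.1)
    (by filter_upwards [hTs] with s hs hsI using hs hsI.1) h0 (t := t) (d := ζmax)
    ⟨htpos.le, le_rfl⟩ hζ0 (by filter_upwards [hζ] with s hs hsI using (hs hsI.1).le)
  have h1 := ht₁ t ((le_max_left _ _).trans ht)
  have h2 : (W.C / W.k * ζmax) ^ (1 / 3 : ℝ) ≤ ρ / 2 := by
    calc (W.C / W.k * ζmax) ^ (1 / 3 : ℝ) ≤ ((ρ / 2) ^ 3) ^ (1 / 3 : ℝ) := by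
          refine Real.rpow_le_rpow (by positivity) ?_ (by norm_num)
          have := mul_le_mul_of_nonneg_left hζρ (by positivity : 0 ≤ W.C / W.k)
          refine this.trans (le_of_eq ?_)
          field_simp
      _ = ρ / 2 := by
          rw [← Real.rpow_natCast, ← Real.rpow_mul (by positivity)]; norm_num
  linarith

end

/-! ### Rate of the thrust vector -/

/-- The thrust vector at the equilibrium. -/
def equilibriumThrust (P : Params) (pd : E3) : E3 :=
  (P.m * P.g) • zHat + P.Tp • (P.L⁻¹ • pd)

/-- Bound for the rate of the proportional force relative to the speed. -/
def forceRate (P : Params) : ℝ :=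
  P.L ^ 2 * (P.Kp / P.μ * P.L + P.Kp * P.L / P.μ * Real.pi * 2)

section
variable {P : Params} {pd δ w x u : E3} {p v : ℝ → E3} {t : ℝ}

theorem norm_sub_desired_sq (hpd : ‖pd‖ = P.L) (hx : ‖x‖ = P.L) :
    ‖x - pd‖ ^ 2 = 2 * P.L ^ 2 * (1 - cosAngle P pd x) := by
  rw [norm_sub_sq_real, hx, hpd, inner_eq_cosAngle P]; ring

theorem norm_desiredThrust_sub_le (hpd : ‖pd‖ = P.L) (hx : ‖x‖ = P.L) :
    ‖desiredThrust P pd x u - equilibriumThrust P pd‖ ≤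
      forceBound P * (1 - cosAngle P pd x) + P.Kd * ‖u‖
        + P.Tp * √(2 * (1 - cosAngle P pd x)) := by
  have hL := P.L_pos
  have h1 : desiredThrust P pd x u - equilibriumThrust P pd =
      (P.L ^ 2 * pdGain P (cosAngle P pd x)) • (pd - cosAngle P pd x • x) - P.Kd • u
        + (P.Tp * P.L⁻¹) • (x - pd) := by
    rw [desiredThrust, equilibriumThrust, pdForce_eq hpd hx]; module
  have h2 : ‖x - pd‖ = P.L * √(2 * (1 - cosAngle P pd x)) := by
    rw [← Real.sqrt_sq (norm_nonneg (x - pd)), norm_sub_desired_sq hpd hx,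
      show 2 * P.L ^ 2 * (1 - cosAngle P pd x) = P.L ^ 2 * (2 * (1 - cosAngle P pd x)) by ring,
      Real.sqrt_mul (sq_nonneg _), Real.sqrt_sq hL.le]
  rw [h1]
  refine (norm_add_le _ _).trans (add_le_add ((norm_sub_le _ _).trans
    (add_le_add (norm_proportional_le hpd hx) (le_of_eq ?_))) (le_of_eq ?_))
  · rw [norm_smul, Real.norm_of_nonneg P.Kd_pos.le]
  · rw [norm_smul, Real.norm_of_nonneg (mul_pos P.Tp_pos (inv_pos.2 hL)).le, h2]
    field_simp

/-- The reaction contributes the centripetal term and a second ‖δ‖, for the normal part of the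
disturbance. -/
theorem HasAcceleration.norm_le (h : HasAcceleration P pd δ p v w t) (hpd : ‖pd‖ = P.L) :
    P.m * ‖w‖ ≤ forceBound P * (1 - cosAngle P pd (p t)) + P.Kd * ‖v t‖ + P.m / P.L * ‖v t‖ ^ 2
      + 2 * ‖δ‖ := by
  have hL := P.L_pos
  have hm := P.m_pos
  have h1 : P.m * ‖w‖ = ‖P.m • w‖ := by rw [norm_smul, Real.norm_of_nonneg hm.le]
  have h2 : ‖((P.m * ‖v t‖ ^ 2 + inner ℝ δ (p t)) / P.L ^ 2) • p t‖
      ≤ P.m / P.L * ‖v t‖ ^ 2 + ‖δ‖ := by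
    rw [norm_smul, h.norm_p, Real.norm_eq_abs, abs_div, abs_of_pos (pow_pos hL 2),
      div_mul_eq_mul_div, div_le_iff₀ (by positivity)]
    have h3 := abs_real_inner_le_norm δ (p t)
    rw [h.norm_p] at h3
    have h4 : |P.m * ‖v t‖ ^ 2 + inner ℝ δ (p t)| ≤ P.m * ‖v t‖ ^ 2 + ‖δ‖ * P.L := by
      refine (abs_add_le _ _).trans (add_le_add (le_of_eq (abs_of_nonneg (by positivity))) h3)
    have e : (P.m / P.L * ‖v t‖ ^ 2 + ‖δ‖) * P.L ^ 2
        = (P.m * ‖v t‖ ^ 2 + ‖δ‖ * P.L) * P.L := by field_simp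
    rw [e]
    gcongr
  have h5 : ‖P.Kd • v t‖ = P.Kd * ‖v t‖ := by
    rw [norm_smul, Real.norm_of_nonneg P.Kd_pos.le]
  rw [h1, h.dynamics]
  have h6 := norm_proportional_le hpd h.norm_p
  refine (norm_sub_le _ _).trans ((add_le_add ((norm_add_le _ _).trans (add_le_add_left
    (norm_sub_le _ _) _)) h2).trans ?_)
  linarith

/-- Near `pd` the threshold μ is active and the gain is a multiple of arccos y. Its derivative has a
factor 1/√(1 - y²), which |⟨v, pd⟩| ≤ L √(1 - y²) ‖v‖ cancels. -/
theorem exists_hasDerivAt_proportional (hpd : ‖pd‖ = P.L) (hp : HasDerivAt p (v t) t)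
    (hsph : ∀ᶠ s in 𝓝 t, ‖p s‖ = P.L) (htan : inner ℝ (p t) (v t) = (0 : ℝ))
    (hpos : 0 < cosAngle P pd (p t))
    (hμ : P.L ^ 3 * √(1 - cosAngle P pd (p t) ^ 2) < P.μ) :
    ∃ G', HasDerivAt (fun s => (P.L ^ 2 * pdGain P (cosAngle P pd (p s))) •
      (pd - cosAngle P pd (p s) • p s)) G' t ∧ ‖G'‖ ≤ forceRate P * ‖v t‖ := by
  have hL := P.L_pos
  have hKp := P.Kp_pos
  have hμ0 := P.μ_pos
  have hpt : ‖p t‖ = P.L := hsph.self_of_nhds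
  have hy : HasDerivAt (fun s => cosAngle P pd (p s)) (inner ℝ (v t) pd / P.L ^ 2) t := by
    have := (hp.inner ℝ (hasDerivAt_const t pd)).div_const (P.L ^ 2)
    simpa [cosAngle] using this
  have hys := abs_inner_desired_le_sqrt hpd hpt htan
  have hy1 := abs_cosAngle_le hpd hpt
  have hrate : 0 ≤ forceRate P := by
    have := Real.pi_pos
    unfold forceRate; positivity
  rcases (abs_le.1 hy1).2.eq_or_lt with h1 | h1
  -- At `pd` arccos is not differentiable, but the force is O(N), and N has derivative 0, so the
  -- force has derivative 0.
  · refine ⟨0, ?_, by rw [norm_zero]; exact mul_nonneg hrate (norm_nonneg _)⟩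
    rw [h1] at hys
    norm_num at hys
    have hN : HasDerivAt (fun s => 1 - cosAngle P pd (p s)) 0 t := by
      have := hy.const_sub 1
      rwa [hys, zero_div, neg_zero] at this
    rw [hasDerivAt_iff_isLittleO] at hN ⊢
    refine Asymptotics.IsBigO.trans_isLittleO ?_ hN
    refine Asymptotics.IsBigO.of_bound (forceBound P) ?_
    filter_upwards [hsph] with s hs
    have := norm_proportional_le hpd hs
    simp only [h1, sub_self, smul_zero, sub_zero, one_smul]
    have hz : pd - p t = 0 := by
      have h2 := norm_sub_desired_sq hpd hpt
      rw [h1, sub_self, mul_zero, sq_eq_zero_iff, norm_eq_zero] at h2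
      rw [← neg_sub, h2, neg_zero]
    rw [hz, smul_zero, sub_zero, Real.norm_of_nonneg (one_sub_cosAngle_mem hpd hs).1]
    exact this
  · set y := cosAngle P pd (p t) with hydef
    have hq : 0 < 1 - y ^ 2 := by nlinarith
    have hσ : 0 < √(1 - y ^ 2) := Real.sqrt_pos.2 hq
    have hφ : HasDerivAt (fun s => pdGain P (cosAngle P pd (p s)))
        (P.Kp * P.L / P.μ * (-(1 / √(1 - y ^ 2)) * (inner ℝ (v t) pd / P.L ^ 2))) t := by
      have h2 := ((Real.hasDerivAt_arccos (by linarith : y ≠ -1) h1.ne).comp t hy).const_mul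
        (P.Kp * P.L / P.μ)
      refine h2.congr_of_eventuallyEq ?_
      have hc : ContinuousAt (fun s => P.L ^ 3 * √(1 - cosAngle P pd (p s) ^ 2)) t :=
        continuousAt_const.mul ((continuousAt_const.sub (hy.continuousAt.pow 2)).sqrt)
      filter_upwards [hc.eventually (gt_mem_nhds hμ)] with s hs
      rw [pdGain, max_eq_right hs.le, Function.comp]
      ring
    have hX : HasDerivAt (fun s => pd - cosAngle P pd (p s) • p s)
        (-(y • v t + (inner ℝ (v t) pd / P.L ^ 2) • p t)) t := (hy.smul hp).const_sub pd
    refine ⟨_, (hφ.const_mul (P.L ^ 2)).smul hX, ?_⟩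
    have hyd : |inner ℝ (v t) pd / P.L ^ 2| ≤ √(1 - y ^ 2) * ‖v t‖ / P.L := by
      rw [abs_div, abs_of_pos (pow_pos hL 2), div_le_div_iff₀ (by positivity) hL]
      nlinarith
    have hσ1 : √(1 - y ^ 2) ≤ 1 := Real.sqrt_le_one.2 (by nlinarith [sq_nonneg y])
    have hφ' : |P.Kp * P.L / P.μ * (-(1 / √(1 - y ^ 2)) * (inner ℝ (v t) pd / P.L ^ 2))|
        ≤ P.Kp / P.μ * ‖v t‖ := by
      rw [abs_mul, abs_mul, abs_neg, abs_of_pos (by positivity : 0 < P.Kp * P.L / P.μ),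
        abs_of_pos (by positivity : 0 < 1 / √(1 - y ^ 2))]
      calc _ ≤ P.Kp * P.L / P.μ * (1 / √(1 - y ^ 2) * (√(1 - y ^ 2) * ‖v t‖ / P.L)) := by gcongr
        _ = _ := by field_simp
    have hX' : ‖-(y • v t + (inner ℝ (v t) pd / P.L ^ 2) • p t)‖ ≤ 2 * ‖v t‖ := by
      rw [norm_neg]
      refine (norm_add_le _ _).trans ?_
      rw [norm_smul, norm_smul, hpt, Real.norm_eq_abs, Real.norm_eq_abs]
      have h3 : |y| * ‖v t‖ ≤ 1 * ‖v t‖ := by gcongr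
      have h4 : |inner ℝ (v t) pd / P.L ^ 2| * P.L ≤ 1 * ‖v t‖ := by
        calc _ ≤ √(1 - y ^ 2) * ‖v t‖ / P.L * P.L := by gcongr
          _ = √(1 - y ^ 2) * ‖v t‖ := by field_simp
          _ ≤ _ := by gcongr
      linarith
    have hXn : ‖pd - y • p t‖ ≤ P.L := by
      rw [hydef, norm_sub_cosAngle_smul hpd hpt, ← hydef]
      nlinarith
    refine (norm_add_le _ _).trans ?_
    rw [norm_smul, norm_smul, Real.norm_eq_abs, Real.norm_eq_abs, abs_mul, abs_mul,
      abs_of_pos (pow_pos hL 2), abs_of_nonneg (pdGain_nonneg P _)]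
    calc _ ≤ P.L ^ 2 * (P.Kp * P.L / P.μ * Real.pi) * (2 * ‖v t‖)
          + P.L ^ 2 * (P.Kp / P.μ * ‖v t‖) * P.L := by
          gcongr
          exact pdGain_le P _
      _ = _ := by rw [forceRate]; ring

theorem HasAcceleration.exists_hasDerivAt_desiredThrust (h : HasAcceleration P pd δ p v w t)
    (hpd : ‖pd‖ = P.L) (hsph : ∀ᶠ s in 𝓝 t, ‖p s‖ = P.L)
    (hpos : 0 < cosAngle P pd (p t))
    (hμ : P.L ^ 3 * √(1 - cosAngle P pd (p t) ^ 2) < P.μ) :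
    ∃ F', HasDerivAt (fun s => desiredThrust P pd (p s) (v s)) F' t ∧
      ‖F'‖ ≤ (forceRate P + P.Tp / P.L) * ‖v t‖ + P.Kd * ‖w‖ := by
  have hL := P.L_pos
  obtain ⟨G', hG', hle⟩ := exists_hasDerivAt_proportional hpd h.deriv_p hsph h.tangent hpos hμ
  have h1 := ((hG'.sub (h.deriv_v.const_smul P.Kd)).add_const ((P.m * P.g) • zHat)).add
    ((h.deriv_p.const_smul P.L⁻¹).const_smul P.Tp)
  refine ⟨_, h1.congr_of_eventuallyEq ?_, ?_⟩
  · filter_upwards [hsph] with s hs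
    rw [desiredThrust, pdForce_eq hpd hs]
    rfl
  · have h2 : ‖P.Tp • P.L⁻¹ • v t‖ = P.Tp / P.L * ‖v t‖ := by
      rw [norm_smul, norm_smul, Real.norm_of_nonneg P.Tp_pos.le,
        Real.norm_of_nonneg (inv_pos.2 hL).le]
      field_simp
    have h3 : ‖P.Kd • w‖ = P.Kd * ‖w‖ := by
      rw [norm_smul, Real.norm_of_nonneg P.Kd_pos.le]
    refine (norm_add_le _ _).trans ?_
    have := norm_sub_le G' (P.Kd • w)
    linarith

end

/-! ### The commanded attitude and its angular velocity -/

theorem quatRot_mk (a b c d : ℝ) : quatRot ⟨a, b, c, d⟩ =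
    !![1 - 2 * (c ^ 2 + d ^ 2), 2 * (b * c - a * d), 2 * (b * d + a * c);
       2 * (b * c + a * d), 1 - 2 * (b ^ 2 + d ^ 2), 2 * (c * d - a * b);
       2 * (b * d - a * c), 2 * (c * d + a * b), 1 - 2 * (b ^ 2 + c ^ 2)] := by
  ext i j
  fin_cases i <;> fin_cases j <;>
    simp [quatRot, quatVec, skew] <;> ring

/-- Angular velocity, in the body frame, of a rotation given by a unit quaternion. -/
def bodyRate (a b c d a' b' c' d' : ℝ) : E3 :=
  !₂[2 * (a * b' - b * a' - c * d' + d * c'), 2 * (a * c' - c * a' - d * b' + b * d'),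
    2 * (a * d' - d * a' - b * c' + c * b')]

/-- For a unit quaternion, q̄ q' is purely imaginary, and twice its vector part is the body rate.
The unit norm enters both directly and through its derivative q · q' = 0. -/
theorem hasDerivAt_quatRot {a b c d : ℝ → ℝ} {a' b' c' d' t : ℝ} (ha : HasDerivAt a a' t)
    (hb : HasDerivAt b b' t) (hc : HasDerivAt c c' t) (hd : HasDerivAt d d' t)
    (hu : ∀ᶠ s in 𝓝 t, a s ^ 2 + b s ^ 2 + c s ^ 2 + d s ^ 2 = 1) (i j : Fin 3) :
    HasDerivAt (fun s => quatRot ⟨a s, b s, c s, d s⟩ i j)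
      ((quatRot ⟨a t, b t, c t, d t⟩ * skew (bodyRate (a t) (b t) (c t) (d t) a' b' c' d')) i j)
      t := by
  have h1 := hu.self_of_nhds
  have h2 : a t * a' + b t * b' + c t * c' + d t * d' = 0 := by
    have := ((((ha.pow 2).add (hb.pow 2)).add (hc.pow 2)).add (hd.pow 2)).congr_of_eventuallyEq
      (f₁ := fun _ => (1 : ℝ)) (hu.mono fun s hs => hs.symm)
    have := this.unique (hasDerivAt_const t (1 : ℝ))
    norm_num at this
    linarith
  have hdiag : ∀ {f g : ℝ → ℝ} {f' g' : ℝ}, HasDerivAt f f' t → HasDerivAt g g' t →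
      HasDerivAt (fun s => 1 - 2 * (f s ^ 2 + g s ^ 2)) (-(4 * (f t * f' + g t * g'))) t := by
    intro f g f' g' hf hg
    convert! (((hf.pow 2).add (hg.pow 2)).const_mul 2).const_sub 1 using 1
    norm_num; ring
  have hoff : ∀ {f g h k : ℝ → ℝ} {f' g' h' k' : ℝ}, HasDerivAt f f' t → HasDerivAt g g' t →
      HasDerivAt h h' t → HasDerivAt k k' t →
      HasDerivAt (fun s => 2 * (f s * g s + h s * k s))
        (2 * (f' * g t + f t * g' + (h' * k t + h t * k'))) t := by
    intro f g h k f' g' h' k' hf hg hh hk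
    exact ((hf.mul hg).add (hh.mul hk)).const_mul 2
  have hoff' : ∀ {f g h k : ℝ → ℝ} {f' g' h' k' : ℝ}, HasDerivAt f f' t → HasDerivAt g g' t →
      HasDerivAt h h' t → HasDerivAt k k' t →
      HasDerivAt (fun s => 2 * (f s * g s - h s * k s))
        (2 * (f' * g t + f t * g' - (h' * k t + h t * k'))) t := by
    intro f g h k f' g' h' k' hf hg hh hk
    exact ((hf.mul hg).sub (hh.mul hk)).const_mul 2
  simp only [quatRot_mk, Matrix.mul_apply, Fin.sum_univ_three]
  fin_cases i <;> fin_cases j <;> simp [bodyRate, skew]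
  · convert! hdiag hc hd using 1; grind
  · convert! hoff' hb hc ha hd using 1; grind
  · convert! hoff hb hd ha hc using 1; grind
  · convert! hoff hb hc ha hd using 1; grind
  · convert! hdiag hb hd using 1; grind
  · convert! hoff' hc hd ha hb using 1; grind
  · convert! hoff' hb hd ha hc using 1; grind
  · convert! hoff hc hd ha hb using 1; grind
  · convert! hdiag hb hc using 1; grind

/-- Normalisation of the unit quaternion of the minimal rotation onto the direction of `F`. -/
def tiltNorm (F : E3) : ℝ := √(2 * ‖F‖ * (‖F‖ + F 2))

section
variable {F : E3}

theorem norm_pos_of_tilt (hF : 0 < ‖F‖ + F 2) : 0 < ‖F‖ := by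
  rcases (norm_nonneg F).eq_or_lt with h | h
  · have : F = 0 := norm_eq_zero.1 h.symm
    simp [this] at hF
  · exact h

theorem tiltNorm_sq (hF : 0 < ‖F‖ + F 2) : tiltNorm F ^ 2 = 2 * ‖F‖ * (‖F‖ + F 2) :=
  Real.sq_sqrt (mul_pos (mul_pos two_pos (norm_pos_of_tilt hF)) hF).le

theorem tiltNorm_pos (hF : 0 < ‖F‖ + F 2) : 0 < tiltNorm F :=
  Real.sqrt_pos.2 (mul_pos (mul_pos two_pos (norm_pos_of_tilt hF)) hF)

/-- The half-angle formulas turn the argument into an algebraic expression, smooth also at upward F,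
where the defining case distinction hides this. -/
theorem tiltQuat_eq (hF : 0 < ‖F‖ + F 2) : tiltQuat F =
    ⟨(‖F‖ + F 2) / tiltNorm F, -F 1 / tiltNorm F, F 0 / tiltNorm F, 0⟩ := by
  have hn := norm_pos_of_tilt hF
  have hS := tiltNorm_pos hF
  have hS2 := tiltNorm_sq hF
  have hFsq := norm_sq_eq_sum F
  by_cases h : F 0 = 0 ∧ F 1 = 0
  · have h2 : ‖F‖ = F 2 := by
      rw [h.1, h.2] at hFsq
      have : (‖F‖ - F 2) * (‖F‖ + F 2) = 0 := by linear_combination hFsq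
      rcases mul_eq_zero.1 this with h3 | h3 <;> linarith
    have h3 : tiltNorm F = ‖F‖ + F 2 := by
      rw [tiltNorm, h2, show 2 * F 2 * (F 2 + F 2) = (F 2 + F 2) ^ 2 by ring,
        Real.sqrt_sq (by linarith)]
    simp only [tiltQuat, h, and_self, h3]
    ext <;> simp [hF.ne']
  · have hρ2 : 0 < F 0 ^ 2 + F 1 ^ 2 := by
      by_contra! hle
      refine h ⟨?_, ?_⟩ <;> nlinarith [sq_nonneg (F 0), sq_nonneg (F 1)]
    set ρ := √(F 0 ^ 2 + F 1 ^ 2) with hρ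
    have hρ0 : 0 < ρ := Real.sqrt_pos.2 hρ2
    have hρsq : ρ ^ 2 = F 0 ^ 2 + F 1 ^ 2 := Real.sq_sqrt hρ2.le
    set z : ℂ := ⟨F 2, ρ⟩ with hz
    have hz0 : z ≠ 0 := fun h0 => hρ0.ne' (by simpa [hz] using congrArg Complex.im h0)
    have hznorm : ‖z‖ = ‖F‖ := by
      rw [← pow_left_inj₀ (norm_nonneg _) (norm_nonneg _) two_ne_zero, ← Complex.normSq_eq_norm_sq,
        Complex.normSq_mk, hFsq, ← sq, ← sq, hρsq]
      ring
    have hcos : Real.cos z.arg = F 2 / ‖F‖ := by rw [Complex.cos_arg hz0, hznorm]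
    have hsin : Real.sin z.arg = ρ / ‖F‖ := by rw [Complex.sin_arg, hznorm]
    have hhalf : Real.cos (z.arg / 2) = tiltNorm F / (2 * ‖F‖) := by
      rw [Real.cos_half (Complex.neg_pi_lt_arg z).le (Complex.arg_le_pi z), hcos,
        Real.sqrt_eq_iff_eq_sq (by
          rw [show (1 + F 2 / ‖F‖) / 2 = (‖F‖ + F 2) / (2 * ‖F‖) by field_simp]; positivity)
          (by positivity), div_pow, hS2]
      field_simp
    have hshalf : Real.sin (z.arg / 2) / ρ = 1 / tiltNorm F := by
      have h1 : Real.sin z.arg = 2 * Real.sin (z.arg / 2) * Real.cos (z.arg / 2) := by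
        rw [← Real.sin_two_mul]; ring_nf
      rw [hsin, hhalf] at h1
      rw [div_eq_div_iff hρ0.ne' hS.ne']
      field_simp at h1
      linarith
    simp only [tiltQuat, h, ← hρ, ← hz, hhalf, hshalf]
    have e : tiltNorm F / (2 * ‖F‖) = (‖F‖ + F 2) / tiltNorm F := by
      rw [div_eq_div_iff (by positivity) hS.ne', ← sq, hS2]; ring
    rw [e]
    ext <;> simp <;> ring

theorem tilt_components_sq (hF : 0 < ‖F‖ + F 2) :
    ((‖F‖ + F 2) / tiltNorm F) ^ 2 + (-F 1 / tiltNorm F) ^ 2 + (F 0 / tiltNorm F) ^ 2 = 1 := by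
  have hS := tiltNorm_pos hF
  have hn := norm_pos_of_tilt hF
  rw [div_pow, div_pow, div_pow, ← add_div, ← add_div, div_eq_one_iff_eq (by positivity),
    tiltNorm_sq hF]
  linear_combination -norm_sq_eq_sum F

theorem tiltQuat_mul_yaw (hF : 0 < ‖F‖ + F 2) (ψ : ℝ) :
    tiltQuat F * axisAngleQuat ψ zHat =
      ⟨(‖F‖ + F 2) / tiltNorm F * Real.cos (ψ / 2),
        -F 1 / tiltNorm F * Real.cos (ψ / 2) + F 0 / tiltNorm F * Real.sin (ψ / 2),
        F 0 / tiltNorm F * Real.cos (ψ / 2) - -F 1 / tiltNorm F * Real.sin (ψ / 2),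
        (‖F‖ + F 2) / tiltNorm F * Real.sin (ψ / 2)⟩ := by
  rw [tiltQuat_eq hF]
  refine (QuaternionAlgebra.mk_mul_mk _ _ _ _ _ _ _ _).trans ?_
  ext <;> simp [zHat]
  ring

theorem contDiffAt_coord (i : Fin 3) (F : E3) : ContDiffAt ℝ 1 (fun F : E3 => F i) F :=
  (EuclideanSpace.proj (𝕜 := ℝ) i).contDiff.contDiffAt

theorem contDiffAt_tiltNorm (hF : 0 < ‖F‖ + F 2) : ContDiffAt ℝ 1 tiltNorm F := by
  have hn := norm_pos_of_tilt hF
  have h1 : ContDiffAt ℝ 1 (fun F : E3 => ‖F‖) F := contDiffAt_norm ℝ (norm_pos_iff.1 hn)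
  exact ((contDiffAt_const.mul h1).mul (h1.add (contDiffAt_coord 2 F))).sqrt
    (mul_pos (mul_pos two_pos hn) hF).ne'

theorem contDiffAt_tilt_re (hF : 0 < ‖F‖ + F 2) :
    ContDiffAt ℝ 1 (fun F : E3 => (‖F‖ + F 2) / tiltNorm F) F :=
  ((contDiffAt_norm ℝ (norm_pos_iff.1 (norm_pos_of_tilt hF))).add (contDiffAt_coord 2 F)).div
    (contDiffAt_tiltNorm hF) (tiltNorm_pos hF).ne'

theorem contDiffAt_tilt_imI (hF : 0 < ‖F‖ + F 2) :
    ContDiffAt ℝ 1 (fun F : E3 => -F 1 / tiltNorm F) F :=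
  (contDiffAt_coord 1 F).neg.div (contDiffAt_tiltNorm hF) (tiltNorm_pos hF).ne'

theorem contDiffAt_tilt_imJ (hF : 0 < ‖F‖ + F 2) :
    ContDiffAt ℝ 1 (fun F : E3 => F 0 / tiltNorm F) F :=
  (contDiffAt_coord 0 F).div (contDiffAt_tiltNorm hF) (tiltNorm_pos hF).ne'

end

theorem exists_eventually_norm_fderiv_le {f : E3 → ℝ} {F₀ : E3}
    (hf : ContDiffAt ℝ 1 f F₀) :
    ∃ C, 0 ≤ C ∧ ∀ᶠ F in 𝓝 F₀, DifferentiableAt ℝ f F ∧ ‖fderiv ℝ f F‖ ≤ C := by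
  have h1 : ∀ᶠ F in 𝓝 F₀, ContDiffAt ℝ 1 f F := hf.eventually (by simp)
  have h2 : ContinuousAt (fderiv ℝ f) F₀ := hf.continuousAt_fderiv one_ne_zero
  refine ⟨‖fderiv ℝ f F₀‖ + 1, by positivity, ?_⟩
  filter_upwards [h1, h2.norm.eventually (gt_mem_nhds (lt_add_one _))] with F hF hF'
  exact ⟨hF.differentiableAt one_ne_zero, hF'.le⟩

theorem norm_bodyRate_sq (a b c d a' b' c' d' : ℝ) : ‖bodyRate a b c d a' b' c' d'‖ ^ 2 =
    4 * ((a ^ 2 + b ^ 2 + c ^ 2 + d ^ 2) * (a' ^ 2 + b' ^ 2 + c' ^ 2 + d' ^ 2)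
      - (a * a' + b * b' + c * c' + d * d') ^ 2) := by
  rw [norm_sq_eq_sum]
  simp [bodyRate]
  ring

theorem norm_bodyRate_le {a b c d a' b' c' d' B : ℝ} (hB : 0 ≤ B)
    (h : a ^ 2 + b ^ 2 + c ^ 2 + d ^ 2 = 1) (h' : a' ^ 2 + b' ^ 2 + c' ^ 2 + d' ^ 2 ≤ B ^ 2) :
    ‖bodyRate a b c d a' b' c' d'‖ ≤ 2 * B := by
  refine le_of_sq_le_sq ?_ (by positivity)
  rw [norm_bodyRate_sq, h]
  nlinarith [sq_nonneg (a * a' + b * b' + c * c' + d * d')]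

/-- Away from the downward thrust directions, the commanded attitude has an angular velocity of the
order of the rate of the thrust vector. -/
theorem exists_angularVelocity_bound {F₀ : E3} (hF₀ : 0 < ‖F₀‖ + F₀ 2) :
    ∃ C, 0 < C ∧ ∀ᶠ F₁ in 𝓝 F₀, ∀ (ψ : ℝ) (F : ℝ → E3) (F' : E3) (t : ℝ), HasDerivAt F F' t →
      F t = F₁ → ∃ ω : E3, ‖ω‖ ≤ C * ‖F'‖ ∧ ∀ i j,
        HasDerivAt (fun s => quatRot (tiltQuat (F s) * axisAngleQuat ψ zHat) i j)
          ((quatRot (tiltQuat (F t) * axisAngleQuat ψ zHat) * skew ω) i j) t := by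
  obtain ⟨C₁, hC₁, h₁⟩ := exists_eventually_norm_fderiv_le (contDiffAt_tilt_re hF₀)
  obtain ⟨C₂, hC₂, h₂⟩ := exists_eventually_norm_fderiv_le (contDiffAt_tilt_imI hF₀)
  obtain ⟨C₃, hC₃, h₃⟩ := exists_eventually_norm_fderiv_le (contDiffAt_tilt_imJ hF₀)
  have hcont : Continuous fun F : E3 => ‖F‖ + F 2 := by fun_prop
  have hev : ∀ᶠ F in 𝓝 F₀, 0 < ‖F‖ + F 2 := hcont.continuousAt.eventually (lt_mem_nhds hF₀)
  -- The factor 2 is that of the body rate; the 1 keeps the constant positive.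
  refine ⟨2 * (C₁ + C₂ + C₃ + 1), by positivity, ?_⟩
  filter_upwards [h₁, h₂, h₃, hev] with F₁ hd₁ hd₂ hd₃ hpos ψ F F' t hF hFt
  subst hFt
  have hx := hd₁.1.hasFDerivAt.comp_hasDerivAt t hF
  have hy := hd₂.1.hasFDerivAt.comp_hasDerivAt t hF
  have hz := hd₃.1.hasFDerivAt.comp_hasDerivAt t hF
  have hx' := (ContinuousLinearMap.le_opNorm _ F').trans
    (mul_le_mul_of_nonneg_right hd₁.2 (norm_nonneg F'))
  have hy' := (ContinuousLinearMap.le_opNorm _ F').trans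
    (mul_le_mul_of_nonneg_right hd₂.2 (norm_nonneg F'))
  have hz' := (ContinuousLinearMap.le_opNorm _ F').trans
    (mul_le_mul_of_nonneg_right hd₃.2 (norm_nonneg F'))
  rw [Real.norm_eq_abs] at hx' hy' hz'
  generalize fderiv ℝ (fun F : E3 => (‖F‖ + F 2) / tiltNorm F) (F t) F' = x' at hx hx'
  generalize fderiv ℝ (fun F : E3 => -F 1 / tiltNorm F) (F t) F' = y' at hy hy'
  generalize fderiv ℝ (fun F : E3 => F 0 / tiltNorm F) (F t) F' = z' at hz hz'
  have hevt : ∀ᶠ s in 𝓝 t, 0 < ‖F s‖ + F s 2 :=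
    (hcont.continuousAt.comp hF.continuousAt).eventually (lt_mem_nhds hpos)
  have hCS := Real.sin_sq_add_cos_sq (ψ / 2)
  have hda := hx.mul_const (Real.cos (ψ / 2))
  have hdb := (hy.mul_const (Real.cos (ψ / 2))).add (hz.mul_const (Real.sin (ψ / 2)))
  have hdc := (hz.mul_const (Real.cos (ψ / 2))).sub (hy.mul_const (Real.sin (ψ / 2)))
  have hdd := hx.mul_const (Real.sin (ψ / 2))
  -- The yaw factor preserves sums of squares, for the quaternion and for its derivative, so the
  -- constant does not depend on ψ.
  have hunit : ∀ {x y z C S : ℝ}, S ^ 2 + C ^ 2 = 1 →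
      (x * C) ^ 2 + (y * C + z * S) ^ 2 + (z * C - y * S) ^ 2 + (x * S) ^ 2
        = x ^ 2 + y ^ 2 + z ^ 2 := by
    intro x y z C S h
    linear_combination (x ^ 2 + y ^ 2 + z ^ 2) * h
  have hder := hasDerivAt_quatRot hda hdb hdc hdd (by
    filter_upwards [hevt] with s hs
    exact (hunit hCS).trans (tilt_components_sq hs))
  set x := (‖F t‖ + F t 2) / tiltNorm (F t) with hxdef
  set y := -F t 1 / tiltNorm (F t) with hydef
  set z := F t 0 / tiltNorm (F t) with hzdef
  refine ⟨bodyRate (x * Real.cos (ψ / 2)) (y * Real.cos (ψ / 2) + z * Real.sin (ψ / 2))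
    (z * Real.cos (ψ / 2) - y * Real.sin (ψ / 2)) (x * Real.sin (ψ / 2))
    (x' * Real.cos (ψ / 2)) (y' * Real.cos (ψ / 2) + z' * Real.sin (ψ / 2))
    (z' * Real.cos (ψ / 2) - y' * Real.sin (ψ / 2)) (x' * Real.sin (ψ / 2)), ?_, fun i j => ?_⟩
  rotate_left
  · rw [tiltQuat_mul_yaw hpos]
    refine (hder i j).congr_of_eventuallyEq ?_
    filter_upwards [hevt] with s hs
    rw [tiltQuat_mul_yaw hs]
    rfl
  · rw [mul_assoc]
    refine norm_bodyRate_le (by positivity) ((hunit hCS).trans (tilt_components_sq hpos)) ?_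
    rw [hunit hCS]
    have h0 := norm_nonneg F'
    have e1 : x' ^ 2 ≤ (C₁ * ‖F'‖) ^ 2 := sq_le_sq.2 (by rwa [abs_of_nonneg (mul_nonneg hC₁ h0)])
    have e2 : y' ^ 2 ≤ (C₂ * ‖F'‖) ^ 2 := sq_le_sq.2 (by rwa [abs_of_nonneg (mul_nonneg hC₂ h0)])
    have e3 : z' ^ 2 ≤ (C₃ * ‖F'‖) ^ 2 := sq_le_sq.2 (by rwa [abs_of_nonneg (mul_nonneg hC₃ h0)])
    have e4 : (C₁ * ‖F'‖) ^ 2 + (C₂ * ‖F'‖) ^ 2 + (C₃ * ‖F'‖) ^ 2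
        ≤ ((C₁ + C₂ + C₃ + 1) * ‖F'‖) ^ 2 := by
      have : C₁ ^ 2 + C₂ ^ 2 + C₃ ^ 2 ≤ (C₁ + C₂ + C₃ + 1) ^ 2 := by
        nlinarith [mul_nonneg hC₁ hC₂, mul_nonneg hC₁ hC₃, mul_nonneg hC₂ hC₃]
      have := mul_le_mul_of_nonneg_right this (sq_nonneg ‖F'‖)
      linarith
    linarith

/-- Otherwise F is a nonpositive multiple of ẑ, which forces pd = ±L ẑ. The upper sign gives F_z = m
g + T_p > 0; for the lower one F_z = m g - T_p > 0 by hypothesis. -/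
theorem equilibriumThrust_tilt_pos {P : Params} {pd : E3} (hpd : ‖pd‖ = P.L)
    (h : pd = -(P.L • zHat) → P.Tp < P.m * P.g) :
    0 < ‖equilibriumThrust P pd‖ + equilibriumThrust P pd 2 := by
  have hL := P.L_pos
  have hTp := P.Tp_pos
  have hmg := mul_pos P.m_pos P.g_pos
  by_contra! hle
  set F := equilibriumThrust P pd with hF
  have hsq := norm_sq_eq_sum F
  have hpsq := norm_sq_eq_sum pd
  have h0 : F 0 = P.Tp / P.L * pd 0 := by
    simp [hF, equilibriumThrust, zHat]; ring
  have h1 : F 1 = P.Tp / P.L * pd 1 := by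
    simp [hF, equilibriumThrust, zHat]; ring
  have h2 : F 2 = P.m * P.g + P.Tp / P.L * pd 2 := by
    simp [hF, equilibriumThrust, zHat]; ring
  have hn := norm_nonneg F
  have h3 : ‖F‖ ^ 2 ≤ F 2 ^ 2 := by nlinarith
  have hF0 : F 0 = 0 := by nlinarith [sq_nonneg (F 0), sq_nonneg (F 1)]
  have hF1 : F 1 = 0 := by nlinarith [sq_nonneg (F 0), sq_nonneg (F 1)]
  have hc : P.Tp / P.L ≠ 0 := (div_pos hTp hL).ne'
  have hp0 : pd 0 = 0 := by
    rw [hF0] at h0; exact (mul_eq_zero.1 h0.symm).resolve_left hc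
  have hp1 : pd 1 = 0 := by
    rw [hF1] at h1; exact (mul_eq_zero.1 h1.symm).resolve_left hc
  rw [hp0, hp1, hpd] at hpsq
  have hF2 : F 2 ≤ 0 := by linarith
  have hp2 : pd 2 = -P.L := by
    have : (P.L - pd 2) * (P.L + pd 2) = 0 := by linear_combination hpsq
    rcases mul_eq_zero.1 this with h4 | h4
    · have : pd 2 = P.L := by linarith
      rw [this, div_mul_cancel₀ _ hL.ne'] at h2
      linarith
    · linarith
  have hpdz : pd = -(P.L • zHat) := by
    ext i
    fin_cases i <;> simp [hp0, hp1, hp2, zHat]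
  have := h hpdz
  rw [hp2] at h2
  have e : P.Tp / P.L * -P.L = -P.Tp := by field_simp
  rw [e] at h2
  linarith

/-! ### The asymptotic gain and the conclusion -/

theorem exists_isAsymptoticGain {P : Params} {pd : E3} {c Tsup : ℝ}
    (W : LyapunovCertificate P pd c Tsup) (hpd : ‖pd‖ = P.L) (hT : 0 < Tsup)
    (hz : pd = -(P.L • zHat) → P.Tp < P.m * P.g) :
    ∃ ζmax : ℝ, 0 < ζmax ∧ ζmax ≤ W.errorBound ∧ ∃ γout : ℝ, 0 ≤ γout ∧ ∀ ψ : ℝ,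
      IsAsymptoticGain P ψ pd {x | ‖x.1‖ = P.L ∧ energy P pd x.1 x.2 ≤ c} ζmax Tsup γout := by
  classical
  have hm := P.m_pos
  have hL := P.L_pos
  have hKd := P.Kd_pos
  have hTp := P.Tp_pos
  have hF := forceBound_pos P
  have hrate : 0 ≤ forceRate P := by
    have := P.Kp_pos; have := P.μ_pos; have := Real.pi_pos
    unfold forceRate; positivity
  obtain ⟨Ca, hCa, hnear⟩ := exists_angularVelocity_bound (equilibriumThrust_tilt_pos hpd hz)
  obtain ⟨r₀, hr₀, hball⟩ := Metric.eventually_nhds_iff.1 hnear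
  obtain ⟨r, ν, κ, hr, hν, hκ, hult⟩ := exists_linear_ultimate_bound P
  -- For ‖v‖, N ≤ η: the linear ultimate bound applies, y > 0 and ‖v‖² ≤ ‖v‖, the threshold μ is
  -- active, and the thrust lies in the ball where the attitude is controlled.
  obtain ⟨η, hη0, hην, hη1, hημ, hηF⟩ : ∃ η : ℝ, 0 < η ∧ η < ν ∧ η < 1 ∧
      P.L ^ 3 * √(2 * η) < P.μ ∧ forceBound P * η + P.Kd * η + P.Tp * √(2 * η) < r₀ := by
    have hpos : ∀ᶠ ε in 𝓝[>] (0 : ℝ), 0 < ε := self_mem_nhdsWithin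
    exact (hpos.and <|
      (eventually_nhdsGT_zero_lt (f := fun η => η) (by fun_prop) rfl hν).and <|
      (eventually_nhdsGT_zero_lt (f := fun η => η) (by fun_prop) rfl one_pos).and <|
      (eventually_nhdsGT_zero_lt (f := fun η => P.L ^ 3 * √(2 * η)) (by fun_prop) (by simp)
        P.μ_pos).and
      (eventually_nhdsGT_zero_lt
        (f := fun η => forceBound P * η + P.Kd * η + P.Tp * √(2 * η)) (by fun_prop) (by simp)
        hr₀)).exists
  -- By the lower bound of the certificate, V ≤ ρ implies ‖v‖ ≤ η and N ≤ η.
  set ρ := W.l * η ^ 2 with hρ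
  have hρ0 : 0 < ρ := mul_pos W.l_pos (pow_pos hη0 2)
  set ζmax := min W.errorBound (W.k / W.C * (ρ / 2) ^ 3) with hζmax
  have hζmax0 : 0 < ζmax := lt_min W.errorBound_pos
    (mul_pos (div_pos W.k_pos W.C_pos) (by positivity))
  set H := forceRate P + P.Tp / P.L
    + P.Kd / P.m * (forceBound P + P.Kd + P.m / P.L + 2) with hH
  have hH0 : 0 < H := by positivity
  set Λ := Ca * H * (2 * r + κ) / κ with hΛ
  have hΛ0 : 0 < Λ := by positivity
  refine ⟨ζmax, hζmax0, min_le_left _ _, Λ * Tsup, by positivity, ?_⟩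
  intro ψ ζ a p v h h0 hζ hTs
  have hTs' : ∀ᵐ s, 0 ≤ s → |‖desiredThrust P pd (p s) (v s)‖| ≤ Tsup := by
    filter_upwards [hTs] with s hs hs0
    rw [abs_of_nonneg (norm_nonneg _)]; exact hs hs0
  obtain ⟨t₀, ht₀, hV⟩ := W.eventually_le hpd h hρ0 hζmax0.le (min_le_left _ _)
    (min_le_right _ _) hζ hTs' h0.2
  have hsmall : ∀ t, t₀ ≤ t → ‖v t‖ ≤ η ∧ 1 - cosAngle P pd (p t) ≤ η := by
    intro t ht
    have h1 := (W.lower (p t) (v t) (norm_p_of_forall h (ht₀.le.trans ht))).trans (hV t ht)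
    have h2 := le_of_mul_le_mul_left h1 W.l_pos
    constructor
    · exact le_of_sq_le_sq (by linarith [sq_nonneg (1 - cosAngle P pd (p t))]) hη0.le
    · exact le_of_sq_le_sq (by linarith [sq_nonneg ‖v t‖]) hη0.le
  set δ : ℝ → E3 := fun t => disturbance ‖desiredThrust P pd (p t) (v t)‖
    (desiredAttitude P ψ pd (p t) (v t)) (ζ t) (a t) with hδ
  have hacc := ae_hasAcceleration_of_forall h hpd
  have hδle : ∀ᵐ t, 0 ≤ t → ‖δ t‖ ≤ Tsup * |ζ t| := by
    filter_upwards [hTs'] with t ht ht0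
    have hsol := h (t + 1) (by linarith)
    have hmem : t ∈ Icc 0 (t + 1) := ⟨ht0, by linarith⟩
    refine (norm_disturbance_le _ (hsol.rotation t hmem) _ (hsol.unit_axis t hmem)).trans ?_
    gcongr
    exact ht ht0
  -- Bundling bound and derivative allows ω_d to be chosen pointwise, before d and ε are given.
  let good : ℝ → E3 → Prop := fun t ω =>
    ‖ω‖ ≤ Ca * H * (1 - cosAngle P pd (p t) + ‖v t‖ + ‖δ t‖) ∧
      ∀ i j, HasDerivAt (fun s => desiredAttitude P ψ pd (p s) (v s) i j)
        ((desiredAttitude P ψ pd (p t) (v t) * skew ω) i j) t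
  have hgood : ∀ᵐ t, t₀ ≤ t → ∃ ω, good t ω := by
    filter_upwards [hacc] with t ht htt
    obtain ⟨w, hw⟩ := ht (ht₀.le.trans htt)
    obtain ⟨hvs, hNs⟩ := hsmall t htt
    have hN := one_sub_cosAngle_mem hpd hw.norm_p
    have hq : √(1 - cosAngle P pd (p t) ^ 2) ≤ √(2 * η) := by
      apply Real.sqrt_le_sqrt
      linarith [sq_nonneg (1 - cosAngle P pd (p t))]
    obtain ⟨F', hF', hF'le⟩ := hw.exists_hasDerivAt_desiredThrust hpd (by
      filter_upwards [lt_mem_nhds (ht₀.trans_le htt)] with s hs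
      exact norm_p_of_forall h hs.le) (by linarith)
      ((mul_le_mul_of_nonneg_left hq (pow_pos hL 3).le).trans_lt hημ)
    have hdist : dist (desiredThrust P pd (p t) (v t)) (equilibriumThrust P pd) < r₀ := by
      rw [dist_eq_norm]
      refine ((norm_desiredThrust_sub_le hpd hw.norm_p).trans ?_).trans_lt hηF
      gcongr
    obtain ⟨ω, hω, hωd⟩ := hball hdist ψ _ F' t hF' rfl
    refine ⟨ω, hω.trans ?_, hωd⟩
    rw [mul_assoc]
    refine mul_le_mul_of_nonneg_left (hF'le.trans ?_) hCa.le
    have hwn := mul_le_mul_of_nonneg_left (hw.norm_le hpd) (div_pos hKd hm).le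
    have e : P.Kd / P.m * (P.m * ‖w‖) = P.Kd * ‖w‖ := by field_simp
    rw [e] at hwn
    have hn0 := norm_nonneg (v t)
    have hD0 := norm_nonneg (δ t)
    have hv2 : ‖v t‖ ^ 2 ≤ ‖v t‖ := by nlinarith
    have h5 : P.Kd / P.m * (forceBound P * (1 - cosAngle P pd (p t)) + P.Kd * ‖v t‖
        + P.m / P.L * ‖v t‖ ^ 2 + 2 * ‖δ t‖) ≤
        P.Kd / P.m * ((forceBound P + P.Kd + P.m / P.L + 2)
          * (1 - cosAngle P pd (p t) + ‖v t‖ + ‖δ t‖)) := by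
      refine mul_le_mul_of_nonneg_left ?_ (by positivity)
      have := mul_le_mul_of_nonneg_left hv2 (by positivity : 0 ≤ P.m / P.L)
      have := mul_nonneg hF.le hn0
      have := mul_nonneg hF.le hD0
      have := mul_nonneg hKd.le hD0
      have := mul_nonneg hKd.le hN.1
      have := mul_nonneg (by positivity : 0 ≤ P.m / P.L) hN.1
      have := mul_nonneg (by positivity : 0 ≤ P.m / P.L) hD0
      linarith [hN.1]
    have h6 : (forceRate P + P.Tp / P.L) * ‖v t‖ ≤
        (forceRate P + P.Tp / P.L) * (1 - cosAngle P pd (p t) + ‖v t‖ + ‖δ t‖) :=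
      mul_le_mul_of_nonneg_left (by linarith [hN.1]) (by positivity)
    rw [hH]
    linarith
  refine ⟨fun t => if ht : ∃ ω, good t ω then ht.choose else 0, t₀, ?_, ?_⟩
  · filter_upwards [hgood] with t ht htt
    have hex := ht htt
    simp only [dif_pos hex]
    exact hex.choose_spec.2
  · rintro d hd ⟨t₁, ht₁⟩ ε hε
    -- The slack ε / Λ keeps b positive when d = 0, as the ultimate bound requires, and costs
    -- exactly ε in the end.
    set b := (Tsup * d + ε / Λ) / κ with hb
    have hb0 : 0 < b := by positivity
    have hκb : κ * b = Tsup * d + ε / Λ := by rw [hb]; field_simp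
    set t₂ := max t₀ t₁ with ht₂
    have h2 : 0 ≤ t₂ := ht₀.le.trans (le_max_left _ _)
    have hδb : ∀ᵐ t, t₂ ≤ t → ‖δ t‖ ≤ κ * b := by
      filter_upwards [hδle, ht₁] with t h3 h4 ht
      have h5 := mul_le_mul_of_nonneg_left (h4 ((le_max_right _ _).trans ht)) hT.le
      have h6 : 0 < ε / Λ := by positivity
      linarith [h3 (h2.trans ht)]
    obtain ⟨t₃, ht₃, hfin⟩ := hult pd p v δ t₂ b hpd hb0
      (fun τ hτ => absolutelyContinuous_p_of_forall h h2 hτ)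
      (fun τ hτ => absolutelyContinuous_v_of_forall h h2 hτ)
      (by filter_upwards [hacc] with t ht htt using ht (h2.trans htt))
      (fun t ht => ⟨norm_p_of_forall h (h2.trans ht),
        tangent_of_forall h (ht₀.trans_le ((le_max_left _ _).trans ht))⟩)
      (fun t ht => (hsmall t ((le_max_left _ _).trans ht)).2.trans hην.le) hδb
    refine ⟨t₃, ?_⟩
    filter_upwards [hgood, hδb] with t h3 h4 ht
    have hex := h3 ((le_max_left _ _).trans (ht₃.trans ht))
    simp only [dif_pos hex]
    refine hex.choose_spec.1.trans ?_
    obtain ⟨h5, h6⟩ := hfin t ht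
    have h7 := h4 (ht₃.trans ht)
    calc Ca * H * (1 - cosAngle P pd (p t) + ‖v t‖ + ‖δ t‖)
        ≤ Ca * H * (r * b + r * b + κ * b) := by gcongr
      _ = Λ * (κ * b) := by rw [hΛ]; field_simp; ring
      _ = Λ * Tsup * d + ε := by rw [hκb]; field_simp

end TetheredUAV

end

theorem proposition2 (P : TetheredUAV.Params) (pd : TetheredUAV.E3) (hpd : ‖pd‖ = P.L)
    (c : ℝ) (hc : c < TetheredUAV.barrier P) (Tsup : ℝ) (hT : 0 < Tsup) :
    ∃ ζmax : ℝ, 0 < ζmax ∧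
      TetheredUAV.ISSWithRestriction P pd
        {x | ‖x.1‖ = P.L ∧ TetheredUAV.energy P pd x.1 x.2 ≤ c} ζmax Tsup ∧
      ((pd = -(P.L • TetheredUAV.zHat) → P.Tp < P.m * P.g) →
        ∃ γout : ℝ, 0 ≤ γout ∧ ∀ ψ : ℝ, TetheredUAV.IsAsymptoticGain P ψ pd
          {x | ‖x.1‖ = P.L ∧ TetheredUAV.energy P pd x.1 x.2 ≤ c} ζmax Tsup γout) := by
  obtain ⟨W⟩ := TetheredUAV.exists_lyapunovCertificate hpd hc hT
  -- One ζmax must serve both parts; if the condition on T_p fails, the second part is vacuous and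
  -- the bound of the certificate is enough.
  by_cases hz : pd = -(P.L • TetheredUAV.zHat) → P.Tp < P.m * P.g
  · obtain ⟨ζmax, h0, hle, hgain⟩ := TetheredUAV.exists_isAsymptoticGain W hpd hT hz
    exact ⟨ζmax, h0, W.iss hpd hle, fun _ => hgain⟩
  · exact ⟨W.errorBound, W.errorBound_pos, W.iss hpd le_rfl, fun h => absurd h hz⟩
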